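/- **Notation.** Let $n,k\ge 0$, $q_1,q_2\in\mathbb C$ with $|q_1|,|q_2|>1$, and $z,a_\alpha,K_\alpha\in\mathbb C^\times$ ($\alpha=1,\dots,n$). Put $(x)_\infty=\prod_{m\ge0}(1-xq_2^{-m})$; for $d\in\mathbb Z$ let $(x)_d=\prod_{m=0}^{d-1}(1-xq_2^{-m})$ if $d\ge0$ and $(x)_d=\prod_{m=1}^{-d}(1-xq_2^{m})^{-1}$ if $d<0$; $\theta(x)=(x)_\infty(q_2^{-1}/x)_\infty$; $a_{\beta\alpha}=a_\beta/a_\alpha$, $K_{1\dots\alpha}=K_1\cdots K_\alpha$, $\rho_i=\frac{k+1}2-i$, and $\varphi_K(\xi,\eta)=\frac{\theta(\xi\eta)\theta(K)}{\theta(K\xi)\theta(\eta)}$. Let $\underline k,\underline\ell\in(\mathbb Z_{\ge0})^n$ with $\sum_\alpha k_\alpha=\sum_\alpha\ell_\alpha=k$, and let $c,c':\{1,\dots,k\}\to\{1,\dots,n\}$ be the weakly decreasing maps taking each value $\alpha$ exactly $k_\alpha$, respectively $\ell_\alpha$, times. An index $I\in\{1,\dots,k\}$ is also written $I=(\alpha,i)$,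 where $\alpha=c'(I)$ and $I=i+\sum_{\alpha'>\alpha}\ell_{\alpha'}$, $1\le i\le\ell_\alpha$; similarly $J=(\beta,j)$. **The block.** The conformal block $\Psi^{\underline k}$ in the chamber $\mathscr C_{1\dots n}$ (after $z\to zq_1^{k-1}$) is $\oint\prod_{i}\frac{dx_i}{2\pi\mathrm i x_i}F(x)$, where $F$ is the normalised vacuum expectation value $$F(x)=\prod_{i=1}^k\varphi_{K_{c(i)}}\!\Big(\tfrac{a_{c(i)}}{x_i},\,zq_1^{-2\rho_i}K_{1\dots c(i)}\Big)\prod_{i<j}\frac{(x_i/x_j)_\infty(q_1^{-1}q_2^{-1}x_i/x_j)_\infty}{(q_2^{-1}x_i/x_j)_\infty(q_1x_i/x_j)_\infty}\prod_i\Big(\prod_{\alpha\ge c(i)}\frac{(K_\alpha a_\alpha/x_i)_\infty}{(a_\alpha/x_i)_\infty}\prod_{\alpha<c(i)}\frac{(q_2^{-1}x_i/a_\alpha)_\infty}{(K_\alpha^{-1}q_2^{-1}x_i/a_\alpha)_\infty}\Big)$$ given by the kernels and the OPE factors of the vertex operators in $\langle \mathsf Z^{(k_1)}_{K_1}(a_1)\cdots\mathsf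 Z^{(k_n)}_{K_n}(a_n)\rangle/\langle\mathsf Z_{K_1}(a_1)\cdots\mathsf Z_{K_n}(a_n)\rangle$. Let $\mathsf P_{\underline\ell}$ be the set of $\underline\nu=(\nu_{\alpha,i})$ with $0\le\nu_{\alpha,1}\le\dots\le\nu_{\alpha,\ell_\alpha}$ integers. Its pole labelled by $\underline\nu$ is $x_{\alpha,i}=a_\alpha q_1^{i-1}q_2^{-\nu_{\alpha,i}}$, together with the points obtained by permuting its $k$ coordinates. The contribution of $\underline\nu$ is the sum over these $k!$ points of the iterated residues of $F\prod dx_i/x_i$, with $x_{\alpha,i+1}$ encircling $q_1q_2^{\nu_{\alpha,i}-\nu_{\alpha,i+1}}x_{\alpha,i}$. The contribution $\Psi^{\underline k}|_{\underline\ell}$ is the sum of these over $\underline\nu\in\mathsf P_{\underline\ell}$. **Stable envelope.** Put $$\operatorname{Stab}_{\underline k}(x)=\operatorname*{Sym}_{x}\ \prod_{i<j}\frac{\theta(q_1x_j/x_i)}{\theta(x_j/x_i)}\prod_{i=1}^k\frac{\prod_{\alpha<c(i)}\theta(a_\alpha/x_i)\ \theta(zq_1^{-2\rho_i}K_{1\dots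 c(i)}a_{c(i)}/x_i)\prod_{\alpha>c(i)}\theta(K_\alpha a_\alpha/x_i)}{\prod_{\alpha=1}^n\theta(K_\alpha a_\alpha/x_i)},$$ ($\operatorname{Sym}$ is the sum over all permutations of $x$), $\mathsf c_{\underline k}=\prod_i\theta(K_{c(i)})/\theta(zq_1^{-2\rho_i}K_{1\dots c(i)})$, and let the on-shell stable envelope be $\operatorname{Stab}_{\underline k;\underline\ell}(\underline a)=\mathsf c_{\underline k}\operatorname{Stab}_{\underline k}(x)$ at $x_{\alpha,i}=a_\alpha q_1^{i-1}$. **Perturbative and vortex parts.** With $\ell_{\beta\alpha}=\ell_\beta-\ell_\alpha$, put $$\mathring Z_{\underline\ell}=\frac{(q_1)_\infty^k}{(q_2^{-1})_\infty^k}\prod_{\alpha,\beta=1}^n\prod_{i=1}^{\ell_\alpha}\frac{(K_\beta a_{\beta\alpha}q_1^{1-i})_\infty}{(a_{\beta\alpha}q_1^{\ell_{\beta\alpha}+i})_\infty},$$ $$Z_{\underline\nu}=\prod_{(\alpha,i)\ne(\beta,j)}\frac{(q_1^{j-i+1}a_{\beta\alpha})_{\nu_{\beta,j}-\nu_{\alpha,i}}}{(q_1^{j-i}a_{\beta\alpha})_{\nu_{\beta,j}-\nu_{\alpha,i}}}\prod_{\alpha,\beta=1}^n\prod_{i=1}^{\ell_\alpha}\frac{(q_1^{1-i}a_{\beta\alpha})_{-\nu_{\alpha,i}}}{(q_1^{1-i}K_\beta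 a_{\beta\alpha})_{-\nu_{\alpha,i}}}.$$ **Genericity.** Assume that $a_\alpha=a_\beta q_1^sq_2^m$ with $s,m\in\mathbb Z$, $|s|\le k$, only if $\alpha=\beta$ and $s=0$; that $K_\beta a_\beta\notin a_\alpha q_1^{i-1}q_2^{\mathbb Z}$ for all $\alpha,\beta$ and $1\le i\le\ell_\alpha$; and that $zq_1^{-2\rho_i}K_{1\dots c(i)}\notin q_2^{\mathbb Z}$ for all $i$. **Proposition.** 1. For every $\underline\nu\in\mathsf P_{\underline\ell}$ the contribution of $\underline\nu$ is $\operatorname{Stab}_{\underline k;\underline\ell}(\underline a)\,\mathring Z_{\underline\ell}\,z^{|\underline\nu|}Z_{\underline\nu}$, where $|\underline\nu|=\sum\nu_{\alpha,i}$. If $|zK_1\cdots K_n|<1$, then $\sum_{\underline\nu}z^{|\underline\nu|}Z_{\underline\nu}$ converges absolutely and $$\Psi^{\underline k}\big|_{\underline\ell}=\operatorname{Stab}_{\underline k;\underline\ell}(\underline a)\,\mathring Z_{\underline\ell}\sum_{\underline\nu\in\mathsf P_{\underline\ell}}z^{|\underline\nu|}Z_{\underline\nu}.$$ 2. If $\underline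 k=\underline\ell$, then $$\operatorname{Stab}_{\underline\ell;\underline\ell}(\underline a)=\prod_{I<J}\frac{\theta(q_1^{j-i+1}a_{\beta\alpha})}{\theta(q_1^{j-i}a_{\beta\alpha})}\prod_{I}\Big(\prod_{\beta<\alpha}\frac{\theta(q_1^{1-i}a_{\beta\alpha})}{\theta(q_1^{1-i}K_\beta a_{\beta\alpha})}\Big)\frac{\theta(q_1^{1-i-2\rho_I}zK_{1\dots\alpha})\,\theta(K_\alpha)}{\theta(q_1^{1-i}K_\alpha)\,\theta(q_1^{-2\rho_I}zK_{1\dots\alpha})}.$$ 3. The factor $z^{|\underline\nu|}$ is the quasi-periodicity factor of the stable envelope: $\operatorname{Stab}_{\underline k}(q_2^{-N_1}x_1,\dots,q_2^{-N_k}x_k)=z^{N_1+\dots+N_k}\operatorname{Stab}_{\underline k}(x)$ for $N\in\mathbb Z^k$, $x\in(\mathbb C^\times)^k$. In particular, $\mathsf c_{\underline k}\operatorname{Stab}_{\underline k}$ at the pole labelled by $\underline\nu$ equals $z^{|\underline\nu|}\operatorname{Stab}_{\underline k;\underline\ell}(\underline a)$. 4. Suppose that $K_\alpha=\kappa$ for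 all $\alpha$, where $\kappa=q_1$ (if $k\le1$, any $\kappa$ is allowed), that $\ell_\alpha\le1$ for all $\alpha$, and that $|z\kappa^n|<1$. Then $\sum_{\underline\nu}z^{|\underline\nu|}Z_{\underline\nu}$ is the K-theoretic vertex function of $X=T^\vee\mathrm{Gr}(k,n)$ at the fixed point $p=\{\alpha:\ell_\alpha=1\}$, with framing weights $a_\alpha$, weight $q=q_2$ of the coordinate of $\mathbb P^1$ at $0$, symplectic weight $\hbar=\kappa q_2$, and quantum parameter $\zeta=z(-\hbar^{1/2}/q_2)^n$ for either root $\hbar^{1/2}$. Here the vertex function is the localization sum $\sum_{d}\zeta^{|d|}\chi(\widehat{\mathcal O}_{\mathrm{vir}})_d$ over the torus-fixed quasimaps $\mathbb P^1\to X$ nonsingular at $\infty$ with value $p$ there, that is, over $\mathcal V=\bigoplus_{\alpha\in p}a_\alpha\mathcal O(d_\alpha)$, $d_\alpha\ge0$ (fibre weights $a_\alpha$ at $\infty$ and $a_\alpha q^{-d_\alpha}$ at $0$), with polarization $P=\mathcal N^\vee\mathcal V-\mathcal V^\vee\mathcal V$, $\mathcal N=\bigoplus_\alpha a_\alpha\mathcal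 O$, $T_{\mathrm{vir}}=H^\bullet(P+\hbar P^\vee)-(P+\hbar P^\vee)|_\infty$, and $\widehat{\mathcal O}_{\mathrm{vir}}=\mathcal O_{\mathrm{vir}}\otimes(\mathcal K_{\mathrm{vir}}\otimes\det P_\infty/\det P_0)^{1/2}$; a weight $w$ of $T_{\mathrm{vir}}$ contributes $(1-w^{-1})^{-1}$ to $\mathcal O_{\mathrm{vir}}$. Explicitly, writing $(x;q)_d=\prod_{m=0}^{d-1}(1-xq^m)$ and $(x;q)_{-d}=\prod_{m=1}^{d}(1-xq^{-m})^{-1}$ for $d\ge0$, each line bundle $\mathcal L$ of $P$ of degree $d$ with weight $x$ at $\infty$ contributes $\frac{(\hbar/x;q)_d}{(q/x;q)_d}(-q/\hbar^{1/2})^d$ to the power of its multiplicity. -/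

import Mathlib

noncomputable section

namespace A1Block

open Finset

/-! ### q-special functions -/

/-- The infinite product `(x; q)_∞ = ∏_{m ≥ 0} (1 - x q^m)` (for `|q| < 1`). -/
def qPochInf (q x : ℂ) : ℂ := ∏' m : ℕ, (1 - x * q ^ m)

/-- The shifted factorial `(x; q)_d` for `d : ℤ`: it is `(1-x)(1-qx)⋯(1-q^{d-1}x)` for `d ≥ 0` and
`(1-q^d x)⁻¹⋯(1-q^{-1}x)⁻¹` for `d < 0` (one of the two products below is always empty). -/
def qPoch (q x : ℂ) (d : ℤ) : ℂ :=
  (∏ m ∈ range d.toNat, (1 - x * q ^ m)) *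
    (∏ m ∈ range (-d).toNat, (1 - x * q ^ (-((m : ℤ) + 1))))⁻¹

/-- The theta function `θ(x; p) = (x; p)_∞ (p/x; p)_∞`. -/
def theta (p x : ℂ) : ℂ := qPochInf p x * qPochInf p (p / x)

/-- The kernel `φ_K(ξ, η; p) = θ(ξη; p) θ(K; p) / (θ(Kξ; p) θ(η; p))`. -/
def phiKernel (p K ξ η : ℂ) : ℂ :=
  theta p (ξ * η) * theta p K / (theta p (K * ξ) * theta p η)

/-! ### Operator product factors of the vertex operators `S = S_2` and `Z_K` -/

/-- The factor of `S(x) S(x')`. -/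
def opeSS (q₁ q₂ x x' : ℂ) : ℂ :=
  (qPochInf q₂⁻¹ (x' / x) * qPochInf q₂⁻¹ ((q₁ * q₂)⁻¹ * x' / x)) /
    (qPochInf q₂⁻¹ (q₂⁻¹ * x' / x) * qPochInf q₂⁻¹ (q₁ * x' / x))

/-- The factor of `S(x) Z_K(x')`. -/
def opeSZ (q₂ K x x' : ℂ) : ℂ :=
  qPochInf q₂⁻¹ (K * x' / x) / qPochInf q₂⁻¹ (x' / x)

/-- The factor of `Z_K(x') S(x)`. -/
def opeZS (q₂ K x' x : ℂ) : ℂ :=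
  qPochInf q₂⁻¹ (q₂⁻¹ * x / x') / qPochInf q₂⁻¹ (K⁻¹ * q₂⁻¹ * x / x')

variable {n k : ℕ}

/-! ### The conformal block

A vector `(k_1, …, k_n)` with `k_1 + ⋯ + k_n = k` is encoded by its colouring
`c : {1, …, k} → {1, …, n}`, the weakly decreasing map with `k_α = #{i | c(i) = α}`: the screening
current `S(x_i)` belongs to `Z^{(k_α)}_{K_α}(a_α)` with `α = c(i)`.  The indices are 0-based in the
code. -/

/-- The number `#{i | c(i) = α}`. -/
def colorCount (c : Fin k → Fin n) (α : Fin n) : ℕ := #{i | c i = α}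

/-- The dynamical argument of the `i`-th kernel.  In
`Z^{(k_1)}_{K_1}(a_1) ⋯ Z^{(k_n)}_{K_n}(a_n)`, each kernel `φ_{K_{c(i)}}(a_{c(i)}/x_i, z K_{c(i)})`
has on its left the currents `S(x_j)`, `j > i`, each of which turns `z` into `q_1^{-2} z`, and
the operators `Z_{K_α}(a_α)`, `α < c(i)`, each of which turns `z` into `K_α z`.  The overall shift
`z → z q_1^{k-1}` is included. -/
def dynParam (q₁ z : ℂ) (K : Fin n → ℂ) (c : Fin k → Fin n) (i : Fin k) : ℂ :=
  (z * q₁ ^ ((k : ℤ) - 1)) * (∏ _j ∈ Ioi i, q₁ ^ (-2 : ℤ)) * (∏ α ∈ Iio (c i), K α) * K (c i)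

/-- The integrand, with respect to `∏ dx_i / (2πi x_i)`, of the normalised vacuum expectation value
`⟨Z^{(k_1)}_{K_1}(a_1) ⋯ Z^{(k_n)}_{K_n}(a_n)⟩ / ⟨Z_{K_1}(a_1) ⋯ Z_{K_n}(a_n)⟩`: the product of all
kernels and of the operator product factors of all pairs of operators, in the order in which
they stand (`S(x_j)` is to the left of `S(x_i)` for `i < j`, and `S(x_i)` is to the left of
`Z_{K_α}(a_α)` exactly when `c(i) ≤ α`). -/
def blockIntegrand (q₁ q₂ z : ℂ) (a K : Fin n → ℂ) (c : Fin k → Fin n) (x : Fin k → ℂ) : ℂ :=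
  (∏ i, phiKernel q₂⁻¹ (K (c i)) (a (c i) / x i) (dynParam q₁ z K c i)) *
  (∏ i, ∏ j ∈ Ioi i, opeSS q₁ q₂ (x j) (x i)) *
  ∏ i, ∏ α, if c i ≤ α then opeSZ q₂ (K α) (x i) (a α) else opeZS q₂ (K α) (a α) (x i)

/-! ### Poles and their contributions -/

/-- If `I` stands for the pair `(α, i)`, with `α = c'(I)` and `i ≥ 1`, this is `i - 1`. -/
def pos (c' : Fin k → Fin n) (I : Fin k) : ℕ := #{J | J < I ∧ c' J = c' I}

/-- Tuples of inverse partitions `ν_{α,1} ≤ ν_{α,2} ≤ ⋯ ≤ ν_{α,ℓ_α}`, `α = 1, …, n`, where `c'` is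
the colouring of `(ℓ_1, …, ℓ_n)`. -/
def InvPart (c' : Fin k → Fin n) : Type :=
  {ν : Fin k → ℕ // ∀ I J, I ≤ J → c' I = c' J → ν I ≤ ν J}

/-- The point `x_{α,i} = a_α q_1^{i-1} q_2^{-ν_{α,i}}`. -/
def pole (q₁ q₂ : ℂ) (a : Fin n → ℂ) (c' : Fin k → Fin n) (ν : Fin k → ℕ) (I : Fin k) : ℂ :=
  a (c' I) * q₁ ^ pos c' I * q₂ ^ (-(ν I : ℤ))

/-- Polyradii for which the torus `|x_I - pole_I| = R_I` is a cycle of the iterated residue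
at the pole: the polar divisor `x_{α,i+1} = q_1 q_2^{ν_{α,i} - ν_{α,i+1}} x_{α,i}` lies inside the
circle of `x_{α,i+1}`, for each `x_{α,i}` on its own circle. -/
def Admissible (q₁ q₂ : ℂ) (c' : Fin k → Fin n) (ν : Fin k → ℕ) (R : Fin k → ℝ) : Prop :=
  ∀ I J, c' I = c' J → pos c' J = pos c' I + 1 →
    ‖q₁ * q₂ ^ ((ν I : ℤ) - (ν J : ℤ))‖ * R I < R J

/-- `v` is the residue of the form `F(x) ∏ dx_i / x_i` at the pole labelled by `ν`, summed over the
`k!` relabellings `x_{w(1)}, …, x_{w(k)}` of the coordinates of that pole. -/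
def HasPoleContribution (q₁ q₂ : ℂ) (a : Fin n → ℂ) (c' : Fin k → Fin n)
    (F : (Fin k → ℂ) → ℂ) (ν : Fin k → ℕ) (v : ℂ) : Prop :=
  ∃ ε : ℝ, 0 < ε ∧ ∀ R : Fin k → ℝ, (∀ I, 0 < R I ∧ R I < ε) → Admissible q₁ q₂ c' ν R →
    (∀ w : Equiv.Perm (Fin k),
      TorusIntegrable (fun x => F x / ∏ i, x i) (pole q₁ q₂ a c' ν ∘ w) (R ∘ w)) ∧
    ∑ w : Equiv.Perm (Fin k), (2 * (Real.pi : ℂ) * Complex.I)⁻¹ ^ k *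
      torusIntegral (fun x => F x / ∏ i, x i) (pole q₁ q₂ a c' ν ∘ w) (R ∘ w) = v

/-- `v` is the contribution to `∮ ∏ dx_i / (2πi x_i) F(x)` of all the poles labelled by
`(ℓ_1, …, ℓ_n)`: the (convergent) sum over tuples of inverse partitions of their contributions. -/
def IsContribution (q₁ q₂ : ℂ) (a : Fin n → ℂ) (c' : Fin k → Fin n)
    (F : (Fin k → ℂ) → ℂ) (v : ℂ) : Prop :=
  ∃ res : InvPart c' → ℂ,
    (∀ ν, HasPoleContribution q₁ q₂ a c' F ν.1 (res ν)) ∧ HasSum res v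

/-! ### Elliptic stable envelope -/

/-- The summand of the off-shell elliptic stable envelope.  With 0-based `i`, the exponent
`2 i + 1 - k` is `-2 ρ_i`. -/
def stabTerm (q₁ q₂ z : ℂ) (a K : Fin n → ℂ) (c : Fin k → Fin n) (x : Fin k → ℂ) : ℂ :=
  (∏ i, ∏ j ∈ Ioi i, theta q₂⁻¹ (q₁ * x j / x i) / theta q₂⁻¹ (x j / x i)) *
  ∏ i, ((∏ α ∈ Iio (c i), theta q₂⁻¹ (a α / x i)) *
      theta q₂⁻¹ (z * q₁ ^ (2 * (i : ℤ) + 1 - k) * (∏ α ∈ Iic (c i), K α) * a (c i) / x i) *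
      (∏ α ∈ Ioi (c i), theta q₂⁻¹ (K α * a α / x i))) /
    ∏ α, theta q₂⁻¹ (K α * a α / x i)

/-- The off-shell elliptic stable envelope: the symmetrisation of `stabTerm` in `x`. -/
def offShellStab (q₁ q₂ z : ℂ) (a K : Fin n → ℂ) (c : Fin k → Fin n) (x : Fin k → ℂ) : ℂ :=
  ∑ w : Equiv.Perm (Fin k), stabTerm q₁ q₂ z a K c (x ∘ w)

/-- The constant `∏_i θ(K_{c(i)}) / θ(z q_1^{-2ρ_i} ∏_{α ≤ c(i)} K_α)`. -/
def blockConst (q₁ q₂ z : ℂ) (K : Fin n → ℂ) (c : Fin k → Fin n) : ℂ :=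
  ∏ i, theta q₂⁻¹ (K (c i)) /
    theta q₂⁻¹ (z * q₁ ^ (2 * (i : ℤ) + 1 - k) * ∏ α ∈ Iic (c i), K α)

/-- The on-shell elliptic stable envelope: the value at `x_{α,i} = a_α q_1^{i-1}`. -/
def onShellStab (q₁ q₂ z : ℂ) (a K : Fin n → ℂ) (c c' : Fin k → Fin n) : ℂ :=
  blockConst q₁ q₂ z K c * offShellStab q₁ q₂ z a K c (pole q₁ q₂ a c' 0)

/-- The product formula for the on-shell stable envelope (`I = (α,i)`, `J = (β,j)`). -/
def onShellProd (q₁ q₂ z : ℂ) (a K : Fin n → ℂ) (c' : Fin k → Fin n) : ℂ :=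
  (∏ I, ∏ J ∈ Ioi I,
    theta q₂⁻¹ (q₁ ^ ((pos c' J : ℤ) - pos c' I + 1) * (a (c' J) / a (c' I))) /
      theta q₂⁻¹ (q₁ ^ ((pos c' J : ℤ) - pos c' I) * (a (c' J) / a (c' I)))) *
  ∏ I : Fin k,
    (∏ β ∈ Iio (c' I),
      theta q₂⁻¹ (q₁ ^ (-(pos c' I : ℤ)) * (a β / a (c' I))) /
        theta q₂⁻¹ (q₁ ^ (-(pos c' I : ℤ)) * K β * (a β / a (c' I)))) *
    ((theta q₂⁻¹ (q₁ ^ (-(pos c' I : ℤ) + (2 * (I : ℤ) + 1 - k)) * z * ∏ α ∈ Iic (c' I), K α) *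
        theta q₂⁻¹ (K (c' I))) /
      (theta q₂⁻¹ (q₁ ^ (-(pos c' I : ℤ)) * K (c' I)) *
        theta q₂⁻¹ (q₁ ^ (2 * (I : ℤ) + 1 - k) * z * ∏ α ∈ Iic (c' I), K α)))

/-! ### Perturbative and vortex parts -/

/-- The perturbative part. -/
def pertPart (q₁ q₂ : ℂ) (a K : Fin n → ℂ) (c' : Fin k → Fin n) : ℂ :=
  qPochInf q₂⁻¹ q₁ ^ k / qPochInf q₂⁻¹ q₂⁻¹ ^ k *
  ∏ I : Fin k, ∏ β,
    qPochInf q₂⁻¹ (K β * (a β / a (c' I)) * q₁ ^ (-(pos c' I : ℤ))) /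
      qPochInf q₂⁻¹ (a β / a (c' I) *
        q₁ ^ ((colorCount c' β : ℤ) - colorCount c' (c' I) + (pos c' I + 1)))

/-- The vortex part `Z_ν`. -/
def vortexPart (q₁ q₂ : ℂ) (a K : Fin n → ℂ) (c' : Fin k → Fin n) (ν : Fin k → ℕ) : ℂ :=
  (∏ I, ∏ J ∈ univ.erase I,
    qPoch q₂⁻¹ (q₁ ^ ((pos c' J : ℤ) - pos c' I + 1) * (a (c' J) / a (c' I))) ((ν J : ℤ) - ν I) /
      qPoch q₂⁻¹ (q₁ ^ ((pos c' J : ℤ) - pos c' I) * (a (c' J) / a (c' I))) ((ν J : ℤ) - ν I)) *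
  ∏ I, ∏ β,
    qPoch q₂⁻¹ (q₁ ^ (-(pos c' I : ℤ)) * (a β / a (c' I))) (-(ν I : ℤ)) /
      qPoch q₂⁻¹ (q₁ ^ (-(pos c' I : ℤ)) * K β * (a β / a (c' I))) (-(ν I : ℤ))

/-- The summand `z^{|ν|} Z_ν` of the vortex sum. -/
def vortexTerm (q₁ q₂ z : ℂ) (a K : Fin n → ℂ) (c' : Fin k → Fin n) (ν : InvPart c') : ℂ :=
  z ^ (∑ I, ν.1 I) * vortexPart q₁ q₂ a K c' ν.1

/-! ### The K-theoretic vertex function of the cotangent bundle of a Grassmannian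

Quasimaps from `ℙ¹` to `X = T^∨Gr(k,n)` (with quiver description `N → V → ħ N`) that are
nonsingular at `∞` are counted by torus localization.  The torus scales the `α`-th basis vector of
the framing `N` with weight `a_α`, the cotangent directions with weight `ħ`, and the coordinate
of `ℙ¹` at `0` with weight `q`.  The fixed points of `X` are the `k`-subsets `p` of `{1, …, n}`,
and the fixed quasimaps with value `p` at `∞` are the bundles `V = ⊕_{α ∈ p} a_α O(d_α)`,
`d_α ≥ 0`, with fibre weight `a_α` at `∞` and `a_α q^{-d_α}` at `0`.  With the polarization
`P = N^∨ V - V^∨ V`, their virtual tangent space is `H^•(P + ħ P^∨)` minus its value at `∞`. -/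

/-- For the equivariant line bundle `L` on `ℙ¹` of degree `d` with weights `x` at `∞` and
`x q^{-d}` at `0`, one has `H^•(L) - L_∞ = x q^{-1} + ⋯ + x q^{-d}` if `d ≥ 0` and
`H^•(L) - L_∞ = -(x + x q + ⋯ + x q^{-d-1})` if `d < 0`.  This is the contribution
`∏ (1 - w⁻¹)^{∓1}` of these weights `w` to the localization formula for the
structure sheaf. -/
def eulerLine (q x : ℂ) (d : ℤ) : ℂ :=
  (∏ m ∈ range d.toNat, (1 - (x * q ^ (-((m : ℤ) + 1)))⁻¹))⁻¹ *
    ∏ m ∈ range (-d).toNat, (1 - (x * q ^ m)⁻¹)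

/-- The determinant of the virtual representation `H^•(L) - L_∞` above. -/
def detLine (q x : ℂ) (d : ℤ) : ℂ :=
  (∏ m ∈ range d.toNat, x * q ^ (-((m : ℤ) + 1))) *
    (∏ m ∈ range (-d).toNat, x * q ^ m)⁻¹

/-- The contribution of `L` (as above) to the square root of
`K_vir ⊗ det P_∞ / det P_0`, where `s` is a square root of `ħ`; see `polarRoot_sq`. -/
def polarRoot (q s x : ℂ) (d : ℤ) : ℂ := s ^ d * x ^ (-d) * q ^ (d * (d + 1) / 2)

lemma tri_succ (d : ℤ) : (d + 1) * (d + 1 + 1) / 2 = d * (d + 1) / 2 + (d + 1) := by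
  have : (d + 1) * (d + 1 + 1) = d * (d + 1) + (d + 1) * 2 := by ring
  rw [this, Int.add_mul_ediv_right _ _ (by norm_num)]

lemma detLine_eq (q x : ℂ) (d : ℤ) (hq : q ≠ 0) :
    detLine q x d = x ^ d * q ^ (-(d * (d + 1) / 2)) := by
  obtain ⟨e, rfl | rfl⟩ := d.eq_nat_or_neg
  · induction e with
    | zero => simp [detLine]
    | succ e ih =>
      have h1 : ∀ e : ℕ, detLine q x e = ∏ m ∈ range e, x * q ^ (-((m : ℤ) + 1)) := by
        intro e; simp [detLine]
      rw [h1] at ih ⊢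
      rw [prod_range_succ, ih]
      have h2 := tri_succ (e : ℤ)
      push_cast
      rw [h2, neg_add (_ / 2 : ℤ), zpow_add₀ hq, show (x ^ ((e : ℤ) + 1)) = x ^ (e : ℤ) * x by
        norm_cast]
      ring
  · induction e with
    | zero => simp [detLine]
    | succ e ih =>
      have h1 : ∀ e : ℕ, detLine q x (-(e : ℤ)) = (∏ m ∈ range e, x * q ^ m)⁻¹ := by
        intro e; simp [detLine]
      rw [h1] at ih ⊢
      rw [prod_range_succ, mul_inv, ih]
      have h2 := tri_succ (-((e : ℤ) + 1))
      have h3 : -((e : ℤ) + 1) + 1 = -e := by ring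
      rw [h3] at h2
      push_cast
      rw [h3, h2, show -(-((e : ℤ) + 1) * -(e : ℤ) / 2 + -(e : ℤ)) =
        -(-((e : ℤ) + 1) * -(e : ℤ) / 2) + e by ring, zpow_add₀ hq]
      have h4 : q ^ (e : ℤ) ≠ 0 := zpow_ne_zero _ hq
      have h5 : x ^ (-((e : ℤ) + 1)) = x ^ (-(e : ℤ)) * x⁻¹ := by
        rw [zpow_neg, zpow_neg, ← mul_inv]; norm_cast
      rw [h5, mul_inv]
      simp only [zpow_natCast] at h4 ⊢
      field_simp

lemma polarRoot_sq (q s x : ℂ) (d : ℤ) (hq : q ≠ 0) (hs : s ≠ 0) (hx : x ≠ 0) :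
    polarRoot q s x d ^ 2 =
      (detLine q x d * detLine q (s ^ 2 / x) (-d))⁻¹ * (x / (x * q ^ (-d))) := by
  have h1 : -d * (-d + 1) / 2 = d * (d + 1) / 2 - d := by
    have : -d * (-d + 1) = d * (d + 1) + (-d) * 2 := by ring
    rw [this, Int.add_mul_ediv_right _ _ (by norm_num)]; ring
  rw [detLine_eq _ _ _ hq, detLine_eq _ _ _ hq, polarRoot, h1, neg_sub, zpow_sub₀ hq,
    div_zpow]
  simp only [zpow_neg]
  have a1 := zpow_ne_zero d hq
  have a2 := zpow_ne_zero d hs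
  have a3 := zpow_ne_zero d hx
  have a4 := zpow_ne_zero (d * (d + 1) / 2) hq
  rw [← zpow_natCast s 2, ← zpow_mul, mul_comm ((2 : ℕ) : ℤ) d, zpow_mul]
  simp only [zpow_natCast]
  field_simp

/-- The contribution of a summand `L` of the polarization (with its dual `ħ L^∨`) to the
symmetrised vertex. -/
def polarFactor (q s x : ℂ) (d : ℤ) : ℂ :=
  eulerLine q x d * eulerLine q (s ^ 2 / x) (-d) * polarRoot q s x d

/-- The contribution `ζ^{deg V} χ(Ô_vir)` of the fixed quasimap of degrees `d`. -/
def vertexTerm (q s ζ : ℂ) (a : Fin n → ℂ) (p : Finset (Fin n)) (d : p → ℕ) : ℂ :=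
  ζ ^ (∑ α, d α) *
    ((∏ α : p, ∏ β, polarFactor q s (a α / a β) (d α)) /
      ∏ α : p, ∏ β : p, polarFactor q s (a α / a β) ((d α : ℤ) - d β))

/-- The restriction to the fixed point `p` of the K-theoretic vertex function of `T^∨Gr(k,n)`,
`k = #p`, with quantum parameter `ζ` and symplectic weight `ħ = s²`. -/
def vertexFunction (q s ζ : ℂ) (a : Fin n → ℂ) (p : Finset (Fin n)) : ℂ :=
  ∑' d : p → ℕ, vertexTerm q s ζ a p d

end A1Block

end

open A1Block

/-!
Put `p = q₂⁻¹`. The kernels and the products of operators standing in the wrong order contribute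
exactly the theta functions of the stable envelope: the integrand is `blockConst * stabTerm` times
the symmetric function `screeningPart` (`blockIntegrand_eq`). Its symmetrisation is thus the
stable envelope, which is holomorphic near the poles, times `screeningPart`.

At most one factor of an infinite product `(u; p)_∞` vanishes at a given point, so each
denominator of `screeningPart` is a linear form times a non-vanishing function
(`qPochInf_eq_mul_qRed`). By genericity the vanishing forms at the pole labelled by `ν` are one
for each box `I = (α, i)`: `y_I - P_I` for the first box of a colour and `y_I - P_I - λ_I (y_{I-1}
- P_{I-1})` for the others (`prod_qLin_eq`). Integrating the variables out from the last to the
first by Cauchy's formula replaces the numerator by its value at the pole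
(`torusIntegral_div_chainDen`). There the stable envelope gives the on-shell one times `z^{|ν|}`,
by quasi-periodicity (`offShellStab_pole`), and the regularised products give `vortexPart` through
the shifts by `p^{ν_J - ν_I}`, and `pertPart` by telescoping along each colour (`regPart_pole`).

The vortex sum is dominated by a geometric series in `z ∏ K_α`, because the interactions of the
boxes are bounded, by `|q₁| > 1` (`summable_vortexTerm`). In the product formula, all permutations
but the identity meet a zero of a theta function (`stabTerm_eq_zero`). If no colour has more than
one box, tuples of inverse partitions are degrees of fixed quasimaps, and the two sums agree term
by term (`vertexTerm_eq_vortexTerm`).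
-/

noncomputable section

namespace A1Block

open Finset

/-! ### Infinite products with the vanishing factors removed -/

/-- The product `(u; p)_∞` without those factors `1 - u p^m` that vanish at `u = u₀`. It is an
entire function of `u` that does not vanish at `u₀`. -/
def qRed (p u₀ u : ℂ) : ℂ := ∏' m : ℕ, if u₀ * p ^ m = 1 then 1 else 1 - u * p ^ m

/-- The value of `(u; p)_∞` at `u` after removal of the vanishing factors. -/
def qReg (p u : ℂ) : ℂ := qRed p u u

section
variable {p : ℂ}

lemma qRed_eq_tprod_one_add (p u₀ u : ℂ) :
    qRed p u₀ u = ∏' m : ℕ, (1 + if u₀ * p ^ m = 1 then 0 else -(u * p ^ m)) := by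
  unfold qRed
  congr 1; ext m; split_ifs <;> ring

lemma summable_qRed (hp : ‖p‖ < 1) (u₀ u : ℂ) :
    Summable fun m : ℕ => ‖if u₀ * p ^ m = 1 then 0 else -(u * p ^ m)‖ := by
  refine .of_nonneg_of_le (fun _ => norm_nonneg _) (fun m => ?_)
    ((summable_geometric_of_lt_one (norm_nonneg p) hp).mul_left ‖u‖)
  split_ifs
  · simp only [norm_zero]; positivity
  · simp

lemma multipliable_qRed (hp : ‖p‖ < 1) (u₀ u : ℂ) :
    Multipliable fun m : ℕ => if u₀ * p ^ m = 1 then 1 else 1 - u * p ^ m := by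
  convert multipliable_one_add_of_summable (summable_qRed hp u₀ u) using 2 with m
  split_ifs <;> ring

lemma qRed_ne_zero (hp : ‖p‖ < 1) {u₀ u : ℂ} (h : ∀ m : ℕ, u * p ^ m = 1 → u₀ * p ^ m = 1) :
    qRed p u₀ u ≠ 0 := by
  rw [qRed_eq_tprod_one_add]
  refine tprod_one_add_ne_zero_of_summable (fun m => ?_) (summable_qRed hp u₀ u)
  split_ifs with hm
  · simp
  · intro h0
    exact hm (h m (by linear_combination -h0))

lemma qReg_ne_zero (hp : ‖p‖ < 1) (u : ℂ) : qReg p u ≠ 0 := qRed_ne_zero hp fun _ => id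

lemma differentiable_qRed (hp : ‖p‖ < 1) (u₀ : ℂ) : Differentiable ℂ (qRed p u₀) := by
  intro u
  set U := Metric.ball (0 : ℂ) (‖u‖ + 1)
  have hU : IsOpen U := Metric.isOpen_ball
  have key : HasProdLocallyUniformlyOn
      (fun (m : ℕ) v => 1 + if u₀ * p ^ m = 1 then 0 else -(v * p ^ m))
      (fun v => ∏' m : ℕ, (1 + if u₀ * p ^ m = 1 then 0 else -(v * p ^ m))) U := by
    refine Summable.hasProdLocallyUniformlyOn_nat_one_add hU
      ((summable_geometric_of_lt_one (norm_nonneg p) hp).mul_left (‖u‖ + 1)) ?_ ?_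
    · refine Filter.Eventually.of_forall fun m v hv => ?_
      have hv' : ‖v‖ ≤ ‖u‖ + 1 := by simpa [U] using (le_of_lt (by simpa [U] using hv))
      split_ifs
      · simp only [norm_zero]; positivity
      · simp only [norm_neg, norm_mul, norm_pow]; gcongr
    · intro m
      split_ifs <;> fun_prop
  have hd : DifferentiableOn ℂ
      (fun v => ∏' m : ℕ, (1 + if u₀ * p ^ m = 1 then 0 else -(v * p ^ m))) U := by
    refine TendstoLocallyUniformlyOn.differentiableOn key (Filter.Eventually.of_forall fun s => ?_) hU
    refine DifferentiableOn.congr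
      (f := fun v => ∏ m ∈ s, (1 + if u₀ * p ^ m = 1 then 0 else -(v * p ^ m))) ?_ (fun v _ => ?_)
    · refine DifferentiableOn.fun_finsetProd fun m _ => ?_
      split_ifs <;> fun_prop
    · simp
  have h2 := hd.differentiableAt (hU.mem_nhds (show u ∈ U by simp [U]))
  exact h2.congr_of_eventuallyEq (.of_forall fun v => qRed_eq_tprod_one_add p u₀ v)

lemma qRed_zero_left (p u : ℂ) : qRed p 0 u = qPochInf p u := by simp [qRed, qPochInf]

lemma differentiable_qPochInf (hp : ‖p‖ < 1) : Differentiable ℂ (qPochInf p) := by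
  have : qPochInf p = qRed p 0 := funext fun u => (qRed_zero_left p u).symm
  rw [this]; exact differentiable_qRed hp 0

lemma qRed_eq_qPochInf {u₀ : ℂ} (h : ∀ m : ℕ, u₀ * p ^ m ≠ 1) (u : ℂ) :
    qRed p u₀ u = qPochInf p u := by simp [qRed, qPochInf, h]

lemma qReg_eq_qPochInf {u : ℂ} (h : ∀ m : ℕ, u * p ^ m ≠ 1) : qReg p u = qPochInf p u :=
  qRed_eq_qPochInf h u

lemma qPochInf_ne_zero (hp : ‖p‖ < 1) {u : ℂ} (h : ∀ m : ℕ, u * p ^ m ≠ 1) :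
    qPochInf p u ≠ 0 := by
  rw [← qReg_eq_qPochInf h]; exact qReg_ne_zero hp u

lemma pow_injective_of_norm_lt_one (hp0 : p ≠ 0) (hp : ‖p‖ < 1) :
    Function.Injective fun m : ℕ => p ^ m := by
  intro m m' h
  refine pow_right_injective₀ (norm_pos_iff.2 hp0) hp.ne ?_
  simpa using congrArg norm h

open Classical in
/-- The factor of `(u; p)_∞` that vanishes at `u = u₀`, and `1` if there is none. -/
def qLin (p u₀ u : ℂ) : ℂ := if ∃ m : ℕ, u₀ * p ^ m = 1 then 1 - u / u₀ else 1

/-- `(u; p)_∞` as a function of `u` near `u₀`: at most one of its factors vanishes at `u₀`, and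
this factor is then `1 - u / u₀`. -/
lemma qPochInf_eq_mul_qRed (hp0 : p ≠ 0) (hp : ‖p‖ < 1) (u₀ u : ℂ) :
    qPochInf p u = qLin p u₀ u * qRed p u₀ u := by
  unfold qLin
  by_cases h : ∃ m : ℕ, u₀ * p ^ m = 1
  · rw [if_pos h]
    obtain ⟨m, hm⟩ := h
    have hu₀ : u₀ ≠ 0 := by rintro rfl; simp at hm
    have huniq : ∀ l : ℕ, u₀ * p ^ l = 1 ↔ l = m := by
      intro l
      refine ⟨fun hl => pow_injective_of_norm_lt_one hp0 hp ?_, fun hl => hl ▸ hm⟩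
      exact mul_left_cancel₀ hu₀ (hl.trans hm.symm)
    have h1 : Multipliable (Function.update (fun l : ℕ => 1 - u * p ^ l) m 1) := by
      convert multipliable_qRed hp u₀ u using 2 with l
      simp [huniq, Function.update_apply]
    rw [qPochInf, Multipliable.tprod_eq_mul_tprod_ite' m h1, qRed]
    simp only [huniq]
    congr 1
    field_simp
    linear_combination -u * hm
  · rw [if_neg h, one_mul, qRed_eq_qPochInf]
    simpa using h

lemma qReg_eq_mul_qReg (hp : ‖p‖ < 1) (u : ℂ) :
    qReg p u = (if u = 1 then 1 else 1 - u) * qReg p (u * p) := by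
  unfold qReg qRed
  have h1 : Multipliable fun m : ℕ =>
      (if u * p ^ (m + 1) = 1 then 1 else 1 - u * p ^ (m + 1)) := by
    have := multipliable_qRed hp (u * p) (u * p)
    refine this.congr fun m => ?_
    rw [pow_succ', ← mul_assoc]
  rw [tprod_eq_zero_mul' (f := fun m : ℕ => if u * p ^ m = 1 then 1 else 1 - u * p ^ m) h1]
  simp [pow_succ', mul_assoc]

lemma qPochInf_eq_mul (hp : ‖p‖ < 1) (u : ℂ) :
    qPochInf p u = (1 - u) * qPochInf p (u * p) := by
  unfold qPochInf
  have h1 : Multipliable fun m : ℕ => 1 - u * p ^ (m + 1) := by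
    have := multipliable_qRed hp 0 (u * p)
    simp only [zero_mul, zero_ne_one, if_false] at this
    refine this.congr fun m => ?_
    rw [pow_succ', ← mul_assoc]
  rw [tprod_eq_zero_mul' (f := fun m : ℕ => 1 - u * p ^ m) h1]
  simp [pow_succ', mul_assoc]

lemma qPoch_natCast (p u : ℂ) (d : ℕ) : qPoch p u d = ∏ m ∈ range d, (1 - u * p ^ m) := by
  simp [qPoch]

lemma qPoch_neg_natCast (p u : ℂ) (d : ℕ) :
    qPoch p u (-(d : ℤ)) = (∏ m ∈ range d, (1 - u * p ^ (-((m : ℤ) + 1))))⁻¹ := by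
  simp [qPoch]

/-- The shifted factorial as a quotient of regularised infinite products, provided that none of its
factors vanishes. -/
lemma qReg_eq_qPoch_mul (hp0 : p ≠ 0) (hp : ‖p‖ < 1) {u : ℂ} {d : ℤ}
    (h : ∀ l : ℤ, (0 ≤ l ∧ l < d ∨ d ≤ l ∧ l < 0) → u * p ^ l ≠ 1) :
    qReg p u = qPoch p u d * qReg p (u * p ^ d) := by
  obtain ⟨e, rfl | rfl⟩ := d.eq_nat_or_neg
  · rw [qPoch_natCast]
    induction e with
    | zero => simp
    | succ e ih =>
      rw [prod_range_succ, ih fun l hl => h l (by omega),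
        qReg_eq_mul_qReg hp (u * p ^ (e : ℤ)), if_neg (h e (by omega)), Nat.cast_succ,
        zpow_add_one₀ hp0, zpow_natCast]
      ring_nf
  · rw [qPoch_neg_natCast]
    induction e with
    | zero => simp
    | succ e ih =>
      have h1 : u * p ^ (-((e : ℤ) + 1)) ≠ 1 := h _ (by push_cast; omega)
      have h2 : u * p ^ (-((e : ℤ) + 1)) * p = u * p ^ (-(e : ℤ)) := by
        rw [mul_assoc, ← zpow_add_one₀ hp0]; ring_nf
      have h3 := qReg_eq_mul_qReg hp (u * p ^ (-((e : ℤ) + 1)))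
      rw [if_neg h1, h2] at h3
      rw [prod_range_succ, ih fun l hl => h l (by push_cast; omega)]
      push_cast
      rw [h3, mul_inv]
      have : 1 - u * p ^ (-((e : ℤ) + 1)) ≠ 0 := sub_ne_zero.2 h1.symm
      field_simp

/-! ### The theta function -/

lemma theta_one (p : ℂ) : theta p 1 = 0 := by
  have : qPochInf p 1 = 0 := by
    unfold qPochInf
    exact tprod_of_exists_eq_zero ⟨0, by simp⟩
  simp [theta, this]

lemma qPochInf_ne_zero_of_theta {p x : ℂ} (h : theta p x ≠ 0) : qPochInf p x ≠ 0 :=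
  left_ne_zero_of_mul h

lemma theta_ne_zero (hp0 : p ≠ 0) (hp : ‖p‖ < 1) {x : ℂ} (hx : x ≠ 0) (h : ∀ m : ℤ, x ≠ p ^ m) :
    theta p x ≠ 0 := by
  refine mul_ne_zero (qPochInf_ne_zero hp fun m hm => h (-m) ?_)
    (qPochInf_ne_zero hp fun m hm => h (m + 1) ?_)
  · rw [zpow_neg, zpow_natCast]; exact eq_inv_of_mul_eq_one_left hm
  · rw [zpow_add_one₀ hp0, zpow_natCast]
    field_simp at hm
    linear_combination -hm

lemma differentiableAt_theta (hp : ‖p‖ < 1) {x : ℂ} (hx : x ≠ 0) :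
    DifferentiableAt ℂ (theta p) x := by
  unfold theta
  have h1 := differentiable_qPochInf hp
  refine (h1 x).mul ((h1 (p / x)).comp x ?_)
  exact (differentiableAt_const p).div differentiableAt_id hx

lemma theta_mul_left (hp : ‖p‖ < 1) {x : ℂ} (hx : x ≠ 0) (hp0 : p ≠ 0) :
    theta p (p * x) = -x⁻¹ * theta p x := by
  unfold theta
  have e1 : p / (p * x) = x⁻¹ := by field_simp
  have h1 := qPochInf_eq_mul hp x
  have h2 := qPochInf_eq_mul hp x⁻¹
  have e2 : x⁻¹ * p = p / x := by ring
  rw [e2] at h2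
  rw [e1, h1, h2, mul_comm x p]
  field_simp
  ring

/-- The quotient `θ(x) / θ(y)` is quasi-periodic under simultaneous shifts of `x` and `y`. -/
lemma theta_zpow_mul_div (hp0 : p ≠ 0) (hp : ‖p‖ < 1) {x y : ℂ} (hx : x ≠ 0) (hy : y ≠ 0) (N : ℤ) :
    theta p (p ^ N * x) / theta p (p ^ N * y) = (y / x) ^ N * (theta p x / theta p y) := by
  have step : ∀ N : ℤ, theta p (p ^ (N + 1) * x) / theta p (p ^ (N + 1) * y) =
      (y / x) * (theta p (p ^ N * x) / theta p (p ^ N * y)) := by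
    intro N
    have hN := zpow_ne_zero N hp0
    rw [zpow_add_one₀ hp0, mul_comm (p ^ N) p, mul_assoc, mul_assoc,
      theta_mul_left hp (mul_ne_zero hN hx) hp0, theta_mul_left hp (mul_ne_zero hN hy) hp0,
      mul_div_mul_comm]
    congr 1
    field_simp
  have hyx : y / x ≠ 0 := div_ne_zero hy hx
  induction N with
  | zero => simp
  | succ N ih => rw [step, ih, zpow_add_one₀ hyx]; ring
  | pred N ih =>
    have := step (-N - 1)
    rw [sub_add_cancel, ih] at this
    rw [zpow_sub_one₀ hyx, mul_right_comm, this]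
    field_simp
end

/-! ### Iterated residues along chains of linear divisors -/

section
open MeasureTheory

variable {k : ℕ}

lemma measurePreserving_comp_perm (w : Equiv.Perm (Fin k)) :
    MeasurePreserving (fun θ : Fin k → ℝ => θ ∘ w) :=
  (volume_measurePreserving_piCongrLeft (fun _ : Fin k => ℝ) w).symm

lemma measurableEmbedding_comp_perm (w : Equiv.Perm (Fin k)) :
    MeasurableEmbedding (fun θ : Fin k → ℝ => θ ∘ w) :=
  (MeasurableEquiv.piCongrLeft (fun _ : Fin k => ℝ) w).symm.measurableEmbedding

lemma preimage_Icc_comp_perm (w : Equiv.Perm (Fin k)) :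
    (fun θ : Fin k → ℝ => θ ∘ w) ⁻¹' (Set.Icc 0 fun _ => 2 * Real.pi) =
      Set.Icc 0 fun _ => 2 * Real.pi := by
  ext θ
  simp only [Set.mem_preimage, Set.mem_Icc, Pi.le_def, Function.comp_apply, Pi.zero_apply]
  exact ⟨fun h => ⟨fun i => by simpa using h.1 (w.symm i), fun i => by simpa using h.2 (w.symm i)⟩,
    fun h => ⟨fun i => h.1 _, fun i => h.2 _⟩⟩

lemma torusIntegrable_comp_perm (w : Equiv.Perm (Fin k)) {f : (Fin k → ℂ) → ℂ} {P : Fin k → ℂ}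
    {R : Fin k → ℝ} (h : TorusIntegrable (fun y => f (y ∘ w)) P R) :
    TorusIntegrable f (P ∘ w) (R ∘ w) := by
  unfold TorusIntegrable at h ⊢
  rw [← (measurePreserving_comp_perm w).integrableOn_comp_preimage
    (measurableEmbedding_comp_perm w), preimage_Icc_comp_perm]
  exact h

lemma torusIntegral_comp_perm (w : Equiv.Perm (Fin k)) (f : (Fin k → ℂ) → ℂ) (P : Fin k → ℂ)
    (R : Fin k → ℝ) :
    torusIntegral f (P ∘ w) (R ∘ w) = torusIntegral (fun y => f (y ∘ w)) P R := by
  unfold torusIntegral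
  rw [← (measurePreserving_comp_perm w).setIntegral_preimage_emb
    (measurableEmbedding_comp_perm w), preimage_Icc_comp_perm]
  congr 1 with θ
  congr 1
  exact Equiv.prod_comp w fun i => (R i : ℂ) * Complex.exp (θ i * Complex.I) * Complex.I

end

/-- The product of the linear forms `(y_I - P_I) - λ_I (y_{I-1} - P_{I-1})`, where `y_{-1} - P_{-1}`
stands for `w`. -/
def chainDen {n : ℕ} (P lam : Fin n → ℂ) (w : ℂ) (y : Fin n → ℂ) : ℂ :=
  ∏ I, (y I - P I - lam I * (Fin.cons w (fun j => y j - P j) : Fin (n + 1) → ℂ) I.castSucc)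

lemma chainDen_ne_zero {n : ℕ} {P lam : Fin n → ℂ} {R : Fin n → ℝ} {w : ℂ}
    (hlam : ∀ I, ‖lam I‖ * (Fin.cons ‖w‖ R : Fin (n + 1) → ℝ) I.castSucc < R I)
    {y : Fin n → ℂ} (hy : ∀ I, ‖y I - P I‖ = R I) : chainDen P lam w y ≠ 0 := by
  refine prod_ne_zero_iff.2 fun I _ h => ?_
  have h1 : ∀ j : Fin (n + 1), ‖(Fin.cons w (fun j => y j - P j) : Fin (n + 1) → ℂ) j‖ =
      (Fin.cons ‖w‖ R : Fin (n + 1) → ℝ) j := by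
    intro j; refine Fin.cases ?_ (fun j => ?_) j <;> simp [hy]
  have h2 := hlam I
  rw [← h1, ← norm_mul, ← sub_eq_zero.1 h, hy] at h2
  exact lt_irrefl _ h2

lemma norm_torusMap_sub {n : ℕ} {P : Fin n → ℂ} {R : Fin n → ℝ} (hR : ∀ I, 0 < R I)
    (θ : Fin n → ℝ) (I : Fin n) : ‖torusMap P R θ I - P I‖ = R I := by
  simp [torusMap, Complex.norm_exp, abs_of_pos (hR I)]

lemma torusIntegrable_div_chainDen {n : ℕ} {P lam : Fin n → ℂ} {R : Fin n → ℝ} {w : ℂ}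
    (hR : ∀ I, 0 < R I)
    (hlam : ∀ I, ‖lam I‖ * (Fin.cons ‖w‖ R : Fin (n + 1) → ℝ) I.castSucc < R I)
    {H : (Fin n → ℂ) → ℂ} (hH : ∀ y, (∀ I, ‖y I - P I‖ ≤ R I) → DifferentiableAt ℂ H y) :
    TorusIntegrable (fun y => H y / chainDen P lam w y) P R := by
  have hmap : Continuous (torusMap P R) := by unfold torusMap; fun_prop
  refine ContinuousOn.integrableOn_compact isCompact_Icc (Continuous.continuousOn ?_)
  refine Continuous.div ?_ ?_ fun θ => chainDen_ne_zero hlam (norm_torusMap_sub hR θ)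
  · refine continuous_iff_continuousAt.2 fun θ => ContinuousAt.comp ?_ hmap.continuousAt
    exact (hH _ fun I => (norm_torusMap_sub hR θ I).le).continuousAt
  · unfold chainDen
    refine continuous_finsetProd _ fun I _ => ?_
    have h1 : ∀ j : Fin (n + 1), Continuous fun θ =>
        (Fin.cons w (fun j => torusMap P R θ j - P j) : Fin (n + 1) → ℂ) j := by
      intro j
      refine Fin.cases ?_ (fun j => ?_) j
      · simpa using continuous_const
      · simp only [Fin.cons_succ]; fun_prop
    have := h1 I.castSucc
    fun_prop

/-- Cauchy's formula for a torus on which the circle of each variable encircles a point depending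
linearly on the preceding variable: the variables are integrated out one by one, starting with the
last. -/
theorem torusIntegral_div_chainDen {n : ℕ} {P lam : Fin n → ℂ} {R : Fin n → ℝ} {w : ℂ}
    (hR : ∀ I, 0 < R I)
    (hlam : ∀ I, ‖lam I‖ * (Fin.cons ‖w‖ R : Fin (n + 1) → ℝ) I.castSucc < R I)
    {H : (Fin n → ℂ) → ℂ} (hH : ∀ y, (∀ I, ‖y I - P I‖ ≤ R I) → DifferentiableAt ℂ H y) :
    (∀ I, ‖w * ∏ J, if J ≤ I then lam J else 1‖ ≤ R I) ∧
    torusIntegral (fun y => H y / chainDen P lam w y) P R =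
      (2 * (Real.pi : ℂ) * Complex.I) ^ n *
        H fun I => P I + w * ∏ J, if J ≤ I then lam J else 1 := by
  induction n generalizing w with
  | zero =>
    refine ⟨fun I => I.elim0, ?_⟩
    rw [torusIntegral_dim0]
    simp only [chainDen, univ_eq_empty, prod_empty, div_one, pow_zero, one_mul]
    congr 1
    exact Subsingleton.elim _ _
  | succ n ih =>
    have h0 : ‖lam 0‖ * ‖w‖ < R 0 := by simpa using hlam 0
    -- the chain that starts after the first variable, with its deviation `w'` from the centre
    have hlam' : ∀ w' : ℂ, ‖w'‖ ≤ R 0 → ∀ I : Fin n, ‖lam I.succ‖ *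
        (Fin.cons ‖w'‖ (fun j => R j.succ) : Fin (n + 1) → ℝ) I.castSucc < R I.succ := by
      intro w' hw' I
      refine lt_of_le_of_lt ?_ (hlam I.succ)
      gcongr
      rw [← Fin.succ_castSucc, Fin.cons_succ]
      refine Fin.cases ?_ (fun j => ?_) I.castSucc <;> simp [hw']
    have hH' : ∀ x : ℂ, ‖x - P 0‖ ≤ R 0 → ∀ y : Fin n → ℂ, (∀ I, ‖y I - P I.succ‖ ≤ R I.succ) →
        DifferentiableAt ℂ (fun y => H (Fin.cons x y)) y := by
      intro x hx y hy
      refine DifferentiableAt.comp y (hH _ fun I => ?_) ?_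
      · induction I using Fin.cases with
        | zero => simpa using hx
        | succ j => simpa using hy j
      · refine differentiableAt_pi.2 (Fin.cases ?_ fun j => ?_)
        · simp
        · simp only [Fin.cons_succ]; fun_prop
    have IH := fun (x : ℂ) (hx : ‖x - P 0‖ ≤ R 0) => ih (P := fun j => P j.succ)
      (lam := fun j => lam j.succ) (R := fun j => R j.succ) (w := x - P 0) (fun I => hR _)
      (hlam' _ hx) (hH' x hx)
    set μ : Fin n → ℂ := fun I => ∏ J, if J ≤ I then lam J.succ else 1 with hμ
    have hprod : ∀ I : Fin n, (∏ J, if J ≤ I.succ then lam J else 1) = lam 0 * μ I := by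
      intro I; simp [Fin.prod_univ_succ, hμ]
    have hprod0 : (∏ J : Fin (n + 1), if J ≤ 0 then lam J else 1) = lam 0 := by
      simp
    have hx0 : ‖(P 0 + lam 0 * w) - P 0‖ ≤ R 0 := by
      rw [add_sub_cancel_left, norm_mul]; exact h0.le
    refine ⟨fun I => ?_, ?_⟩
    · induction I using Fin.cases with
      | zero => rw [hprod0, norm_mul, mul_comm]; exact h0.le
      | succ I =>
        have := (IH _ hx0).1 I
        rw [hprod]
        convert this using 2
        simp only [hμ]; ring
    rw [torusIntegral_succ (torusIntegrable_div_chainDen hR hlam hH)]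
    have hinner : ∀ x ∈ Metric.sphere (P 0) (R 0),
        torusIntegral (fun y => H (Fin.cons x y) / chainDen P lam w (Fin.cons x y))
          (P ∘ Fin.succ) (R ∘ Fin.succ) =
        (x - (P 0 + lam 0 * w))⁻¹ • ((2 * (Real.pi : ℂ) * Complex.I) ^ n *
          H (Fin.cons x fun I => P I.succ + (x - P 0) * μ I)) := by
      intro x hx
      have hx' : ‖x - P 0‖ ≤ R 0 := by simpa [dist_eq_norm] using (le_of_eq hx)
      rw [← (IH x hx').2, smul_eq_mul, ← torusIntegral_const_mul]
      congr 1
      ext y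
      have hden : chainDen P lam w (Fin.cons x y) = (x - (P 0 + lam 0 * w)) *
          chainDen (fun j => P j.succ) (fun j => lam j.succ) (x - P 0) y := by
        unfold chainDen
        rw [Fin.prod_univ_succ]
        congr 1
        · simp; ring
        · refine prod_congr rfl fun I _ => ?_
          rw [← Fin.succ_castSucc, Fin.cons_succ, Fin.cons_succ]
          congr 2
          refine Fin.cases ?_ (fun j => ?_) I.castSucc <;> simp
      rw [hden, div_eq_mul_inv, mul_inv, div_eq_mul_inv]
      ring
    rw [circleIntegral.integral_congr (hR 0).le hinner]
    have hdiff : DifferentiableOn ℂ (fun x => (2 * (Real.pi : ℂ) * Complex.I) ^ n *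
        H (Fin.cons x fun I => P I.succ + (x - P 0) * μ I)) (Metric.closedBall (P 0) (R 0)) := by
      intro x hx
      have hx' : ‖x - P 0‖ ≤ R 0 := by simpa [dist_eq_norm] using hx
      refine DifferentiableAt.differentiableWithinAt (DifferentiableAt.const_mul ?_ _)
      refine DifferentiableAt.comp (g := H)
        (f := fun x : ℂ => (Fin.cons x fun I => P I.succ + (x - P 0) * μ I : Fin (n + 1) → ℂ)) x
        (hH _ fun I => ?_) ?_
      · induction I using Fin.cases with
        | zero => simpa using hx'
        | succ j => simpa [hμ] using (IH x hx').1 j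
      · refine differentiableAt_pi.2 (Fin.cases ?_ fun j => ?_)
        · simp
        · simp only [Fin.cons_succ]; fun_prop
    rw [hdiff.circleIntegral_sub_inv_smul (w := P 0 + lam 0 * w)
      (by simpa [dist_eq_norm] using h0), smul_eq_mul, ← mul_assoc, ← pow_succ']
    congr 2
    ext I
    refine Fin.cases ?_ (fun j => ?_) I
    · rw [Fin.cons_zero, hprod0]; ring
    · rw [Fin.cons_succ, hprod]; ring

variable {n k : ℕ}

/-! ### The integrand as stable envelope times a symmetric function -/

lemma prod_Iio_mul_Ioi {M : Type*} [CommMonoid M] (α : Fin n) (f h : Fin n → M) (g : M) :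
    ∏ β, (if β < α then f β else if β = α then g else h β) =
      (∏ β ∈ Iio α, f β) * g * ∏ β ∈ Ioi α, h β := by
  have hsplit : (univ : Finset (Fin n)) = (Iio α ∪ {α}) ∪ Ioi α := by
    ext β; simp only [mem_univ, mem_union, mem_Iio, mem_singleton, mem_Ioi, true_iff]
    rcases lt_trichotomy β α with h | h | h <;> simp [h]
  rw [hsplit, prod_union, prod_union, prod_singleton]
  · congr 1
    · congr 1
      · refine prod_congr rfl fun β hβ => if_pos (mem_Iio.1 hβ)
      · simp
    · refine prod_congr rfl fun β hβ => ?_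
      have := mem_Ioi.1 hβ
      rw [if_neg this.not_gt, if_neg this.ne']
  · simp
  · rw [disjoint_left]
    intro β hβ hβ'
    simp only [mem_union, mem_Iio, mem_singleton, mem_Ioi] at hβ hβ'
    rcases hβ with h | rfl
    · exact lt_asymm h hβ'
    · exact lt_irrefl _ hβ'

lemma prod_erase_eq_prod_Ioi {M : Type*} [CommMonoid M] (g : Fin k → Fin k → M) :
    ∏ i, ∏ j ∈ univ.erase i, g i j = ∏ i, ∏ j ∈ Ioi i, g i j * g j i := by
  have h1 : ∀ i : Fin k, ∏ j ∈ univ.erase i, g i j =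
      (∏ j ∈ Ioi i, g i j) * ∏ j ∈ Iio i, g i j := by
    intro i
    rw [← prod_union]
    · congr 1
      ext j; simp only [mem_erase, mem_univ, and_true, mem_union, mem_Ioi, mem_Iio]; omega
    · rw [disjoint_left]
      intro j hj hj'
      exact lt_asymm (mem_Ioi.1 hj) (mem_Iio.1 hj')
  simp only [h1, prod_mul_distrib]
  congr 1
  exact prod_comm' (by simp)

lemma prod_erase_comp_perm {M : Type*} [CommMonoid M] (w : Equiv.Perm (Fin k))
    (g : Fin k → Fin k → M) :
    ∏ i, ∏ j ∈ univ.erase i, g (w i) (w j) = ∏ i, ∏ j ∈ univ.erase i, g i j :=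
  Fintype.prod_equiv w _ _ fun i => prod_equiv w (by simp) (by simp)

lemma prod_Iic_eq (K : Fin n → ℂ) (α : Fin n) :
    ∏ β ∈ Iic α, K β = (∏ β ∈ Iio α, K β) * K α := by
  rw [← Iio_insert, prod_insert (by simp), mul_comm]

lemma dynParam_eq {q₁ : ℂ} (hq₁ : q₁ ≠ 0) (z : ℂ) (K : Fin n → ℂ) (c : Fin k → Fin n) (i : Fin k) :
    dynParam q₁ z K c i = z * q₁ ^ (2 * (i : ℤ) + 1 - k) * ∏ α ∈ Iic (c i), K α := by
  have hi := i.2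
  rw [prod_Iic_eq, dynParam, prod_const, Fin.card_Ioi, ← zpow_natCast (q₁ ^ (-2 : ℤ)), ← zpow_mul,
    mul_assoc z, ← zpow_add₀ hq₁,
    show (k : ℤ) - 1 + -2 * ((k - 1 - i : ℕ) : ℤ) = 2 * (i : ℤ) + 1 - k by omega]
  ring

/-- The symmetric factor of the integrand that carries its poles. -/
def screeningPart (q₁ q₂ : ℂ) (a K : Fin n → ℂ) (x : Fin k → ℂ) : ℂ :=
  (∏ I, ∏ J ∈ univ.erase I,
    qPochInf q₂⁻¹ (x J / x I) / qPochInf q₂⁻¹ (q₁ * (x J / x I))) *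
  ∏ I, ∏ β, qPochInf q₂⁻¹ (K β * a β / x I) / qPochInf q₂⁻¹ (a β / x I)

lemma screeningPart_comp_perm (q₁ q₂ : ℂ) (a K : Fin n → ℂ) (x : Fin k → ℂ)
    (w : Equiv.Perm (Fin k)) :
    screeningPart q₁ q₂ a K (x ∘ w) = screeningPart q₁ q₂ a K x := by
  unfold screeningPart
  congr 1
  · exact prod_erase_comp_perm w fun I J =>
      qPochInf q₂⁻¹ (x J / x I) / qPochInf q₂⁻¹ (q₁ * (x J / x I))
  · exact Equiv.prod_comp w fun I =>
      ∏ β, qPochInf q₂⁻¹ (K β * a β / x I) / qPochInf q₂⁻¹ (a β / x I)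

lemma opeSS_eq {q₁ q₂ x x' : ℂ} (hq₁ : q₁ ≠ 0) (hx : x ≠ 0) (hx' : x' ≠ 0)
    (h1 : qPochInf q₂⁻¹ (x / x') ≠ 0) (h2 : qPochInf q₂⁻¹ (q₁ * (x / x')) ≠ 0) :
    opeSS q₁ q₂ x x' = theta q₂⁻¹ (q₁ * x / x') / theta q₂⁻¹ (x / x') *
      (qPochInf q₂⁻¹ (x / x') / qPochInf q₂⁻¹ (q₁ * (x / x')) *
        (qPochInf q₂⁻¹ (x' / x) / qPochInf q₂⁻¹ (q₁ * (x' / x)))) := by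
  unfold opeSS theta
  have e1 : q₂⁻¹ / (q₁ * x / x') = (q₁ * q₂)⁻¹ * x' / x := by field_simp
  have e2 : q₂⁻¹ / (x / x') = q₂⁻¹ * x' / x := by field_simp
  rw [e1, e2, mul_div_assoc q₁ x x', mul_div_assoc q₁ x' x]
  set A := qPochInf q₂⁻¹ (x / x')
  set B := qPochInf q₂⁻¹ (q₁ * (x / x'))
  rw [mul_div_mul_comm B, mul_div_mul_comm (qPochInf q₂⁻¹ (x' / x))]
  field_simp

lemma opeZS_eq {q₂ K a x : ℂ} (hx : x ≠ 0) (ha : a ≠ 0) (hK : K ≠ 0)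
    (h1 : qPochInf q₂⁻¹ (a / x) ≠ 0) (h2 : qPochInf q₂⁻¹ (K * a / x) ≠ 0) :
    opeZS q₂ K a x = theta q₂⁻¹ (a / x) / theta q₂⁻¹ (K * a / x) *
      (qPochInf q₂⁻¹ (K * a / x) / qPochInf q₂⁻¹ (a / x)) := by
  unfold opeZS theta
  have e1 : q₂⁻¹ / (a / x) = q₂⁻¹ * x / a := by field_simp
  have e2 : q₂⁻¹ / (K * a / x) = K⁻¹ * q₂⁻¹ * x / a := by field_simp
  rw [e1, e2]
  generalize qPochInf q₂⁻¹ (a / x) = A at *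
  generalize qPochInf q₂⁻¹ (K * a / x) = B at *
  rw [mul_div_mul_comm]
  generalize qPochInf q₂⁻¹ (q₂⁻¹ * x / a) / qPochInf q₂⁻¹ (K⁻¹ * q₂⁻¹ * x / a) = X
  field_simp

/-- The theta functions of the stable envelope are what remains of the kernels, of the factors of
`S(x_j) S(x_i)` and of those of `Z_K(a) S(x)` after the symmetric factor has been split off. -/
lemma blockIntegrand_eq {q₁ q₂ z : ℂ} {a K : Fin n → ℂ} {c : Fin k → Fin n} {x : Fin k → ℂ}
    (hq₁ : q₁ ≠ 0) (ha : ∀ α, a α ≠ 0) (hK : ∀ α, K α ≠ 0) (hx : ∀ i, x i ≠ 0)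
    (h1 : ∀ i j, i ≠ j → qPochInf q₂⁻¹ (x j / x i) ≠ 0)
    (h2 : ∀ i j, i ≠ j → qPochInf q₂⁻¹ (q₁ * (x j / x i)) ≠ 0)
    (h3 : ∀ i α, qPochInf q₂⁻¹ (a α / x i) ≠ 0)
    (h4 : ∀ i α, theta q₂⁻¹ (K α * a α / x i) ≠ 0) :
    blockIntegrand q₁ q₂ z a K c x =
      blockConst q₁ q₂ z K c * stabTerm q₁ q₂ z a K c x * screeningPart q₁ q₂ a K x := by
  have hSS : ∏ i, ∏ j ∈ Ioi i, opeSS q₁ q₂ (x j) (x i) =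
      (∏ i, ∏ j ∈ Ioi i, theta q₂⁻¹ (q₁ * x j / x i) / theta q₂⁻¹ (x j / x i)) *
      ∏ i, ∏ j ∈ univ.erase i,
        qPochInf q₂⁻¹ (x j / x i) / qPochInf q₂⁻¹ (q₁ * (x j / x i)) := by
    rw [prod_erase_eq_prod_Ioi, ← prod_mul_distrib]
    refine prod_congr rfl fun i _ => ?_
    rw [← prod_mul_distrib]
    refine prod_congr rfl fun j hj => ?_
    have hij := (mem_Ioi.1 hj).ne
    exact opeSS_eq hq₁ (hx j) (hx i) (h1 i j hij) (h2 i j hij)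
  have hZ : ∀ i, phiKernel q₂⁻¹ (K (c i)) (a (c i) / x i) (dynParam q₁ z K c i) *
      (∏ α, if c i ≤ α then opeSZ q₂ (K α) (x i) (a α) else opeZS q₂ (K α) (a α) (x i)) =
      (theta q₂⁻¹ (K (c i)) /
        theta q₂⁻¹ (z * q₁ ^ (2 * (i : ℤ) + 1 - k) * ∏ α ∈ Iic (c i), K α)) *
      (((∏ α ∈ Iio (c i), theta q₂⁻¹ (a α / x i)) *
        theta q₂⁻¹ (z * q₁ ^ (2 * (i : ℤ) + 1 - k) * (∏ α ∈ Iic (c i), K α) * a (c i) / x i) *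
        (∏ α ∈ Ioi (c i), theta q₂⁻¹ (K α * a α / x i))) /
          ∏ α, theta q₂⁻¹ (K α * a α / x i)) *
      ∏ β, qPochInf q₂⁻¹ (K β * a β / x i) / qPochInf q₂⁻¹ (a β / x i) := by
    intro i
    set η := z * q₁ ^ (2 * (i : ℤ) + 1 - k) * ∏ α ∈ Iic (c i), K α with hη
    have hterm : ∀ α, (if c i ≤ α then opeSZ q₂ (K α) (x i) (a α) else
        opeZS q₂ (K α) (a α) (x i)) =
        (if α < c i then theta q₂⁻¹ (a α / x i) / theta q₂⁻¹ (K α * a α / x i) else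
          if α = c i then 1 else 1) *
        (qPochInf q₂⁻¹ (K α * a α / x i) / qPochInf q₂⁻¹ (a α / x i)) := by
      intro α
      by_cases hα : c i ≤ α
      · rw [if_pos hα, if_neg hα.not_gt, ite_self, one_mul, opeSZ]
      · rw [if_neg hα, if_pos (not_le.1 hα)]
        exact opeZS_eq (hx i) (ha α) (hK α) (h3 i α) (qPochInf_ne_zero_of_theta (h4 i α))
    have hden : ∏ α, theta q₂⁻¹ (K α * a α / x i) =
        (∏ α ∈ Iio (c i), theta q₂⁻¹ (K α * a α / x i)) * theta q₂⁻¹ (K (c i) * a (c i) / x i) *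
          ∏ α ∈ Ioi (c i), theta q₂⁻¹ (K α * a α / x i) := by
      rw [← prod_Iio_mul_Ioi]
      refine prod_congr rfl fun α _ => ?_
      split_ifs with _ h
      · rfl
      · rw [h]
      · rfl
    have hIoi : ∏ α ∈ Ioi (c i), theta q₂⁻¹ (K α * a α / x i) ≠ 0 :=
      prod_ne_zero_iff.2 fun α _ => h4 i α
    rw [prod_congr rfl fun α _ => hterm α, prod_mul_distrib, prod_Iio_mul_Ioi, hden,
      phiKernel, dynParam_eq hq₁, ← hη, prod_div_distrib, prod_const_one]
    rw [show a (c i) / x i * η = η * a (c i) / x i by ring,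
      show K (c i) * (a (c i) / x i) = K (c i) * a (c i) / x i by ring, mul_one, mul_one,
      mul_div_mul_right _ _ hIoi]
    ring
  have hZ' := prod_congr (rfl : (univ : Finset (Fin k)) = univ) fun i _ => hZ i
  rw [prod_mul_distrib, prod_mul_distrib, prod_mul_distrib] at hZ'
  rw [blockIntegrand, mul_right_comm, hZ', hSS, blockConst, stabTerm, screeningPart]
  ring

/-! ### Colourings and positions -/

section
variable {c' : Fin k → Fin n}

lemma pos_lt_pos {I J : Fin k} (hIJ : I < J) (h : c' I = c' J) : pos c' I < pos c' J := by
  refine card_lt_card ⟨fun L hL => ?_, fun hs => ?_⟩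
  · simp only [mem_filter, mem_univ, true_and] at hL ⊢
    exact ⟨hL.1.trans hIJ, hL.2.trans h⟩
  · have := hs (by simp [hIJ, h] : I ∈ _)
    simp at this

lemma eq_of_pos_eq {I J : Fin k} (h : c' I = c' J) (hp : pos c' I = pos c' J) : I = J := by
  rcases lt_trichotomy I J with hIJ | hIJ | hIJ
  · exact absurd hp (pos_lt_pos hIJ h).ne
  · exact hIJ
  · exact absurd hp (pos_lt_pos hIJ h.symm).ne'

lemma lt_of_pos_lt {I J : Fin k} (h : c' I = c' J) (hp : pos c' I < pos c' J) : I < J := by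
  rcases lt_trichotomy I J with hIJ | rfl | hIJ
  · exact hIJ
  · exact absurd hp (lt_irrefl _)
  · exact absurd hp (pos_lt_pos hIJ h.symm).not_gt

lemma pos_lt_colorCount (I : Fin k) : pos c' I < colorCount c' (c' I) := by
  refine card_lt_card ⟨fun L hL => ?_, fun hs => ?_⟩
  · simp only [mem_filter, mem_univ, true_and] at hL ⊢
    exact hL.2
  · have := hs (by simp : I ∈ _)
    simp at this

lemma colorCount_le (c' : Fin k → Fin n) (α : Fin n) : colorCount c' α ≤ k :=
  (card_filter_le _ _).trans_eq (card_fin k)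

lemma pos_lt (I : Fin k) : pos c' I < k := (pos_lt_colorCount I).trans_le (colorCount_le c' _)

/-- The index that precedes `I` (and `I` itself for the first index). -/
def prevIdx (I : Fin k) : Fin k := ⟨I - 1, by omega⟩

/-- The boxes of one colour are contiguous. -/
lemma pos_prevIdx (hc' : Antitone c') {I : Fin k} (hI : pos c' I ≠ 0) :
    (I : ℕ) ≠ 0 ∧ c' (prevIdx I) = c' I ∧ pos c' I = pos c' (prevIdx I) + 1 := by
  obtain ⟨J, hJ⟩ := card_ne_zero.1 hI
  simp only [mem_filter, mem_univ, true_and] at hJ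
  have hJI : (J : ℕ) < I := hJ.1
  have hle : J ≤ prevIdx I := by simp only [prevIdx, Fin.le_def]; omega
  have hlt : prevIdx I < I := by simp only [prevIdx, Fin.lt_def]; omega
  have hcol : c' (prevIdx I) = c' I :=
    le_antisymm ((hc' hle).trans_eq hJ.2) (hc' hlt.le)
  refine ⟨by omega, hcol, ?_⟩
  have hset : ({L | L < I ∧ c' L = c' I} : Finset (Fin k)) =
      insert (prevIdx I) ({L | L < prevIdx I ∧ c' L = c' (prevIdx I)} : Finset (Fin k)) := by
    ext L
    simp only [mem_filter, mem_univ, true_and, mem_insert, hcol]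
    have : L < I ↔ L = prevIdx I ∨ L < prevIdx I := by
      simp only [prevIdx, Fin.lt_def, Fin.ext_iff]; omega
    rw [this]
    constructor
    · rintro ⟨h | h, h'⟩
      · exact .inl h
      · exact .inr ⟨h, h'⟩
    · rintro (h | h)
      · exact ⟨.inl h, h ▸ hcol⟩
      · exact ⟨.inr h.1, h.2⟩
  rw [pos, hset, card_insert_of_notMem (by simp)]
  rfl

lemma eq_prevIdx (hc' : Antitone c') {I J : Fin k} (h : c' J = c' I)
    (hp : pos c' I = pos c' J + 1) :
    J = prevIdx I := by
  obtain ⟨_, h1, h2⟩ := pos_prevIdx hc' (I := I) (by omega)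
  exact eq_of_pos_eq (h.trans h1.symm) (by omega)

/-- The boxes of one colour are labelled by `0, 1, …` through their position. -/
lemma prod_filter_color {M : Type*} [CommMonoid M] (c' : Fin k → Fin n) (β : Fin n) (f : ℕ → M) :
    ∏ J with c' J = β, f (pos c' J) = ∏ j ∈ range (colorCount c' β), f j := by
  have hinj : Set.InjOn (pos c') (({J | c' J = β} : Finset (Fin k)) : Set (Fin k)) := by
    intro I hI J hJ h
    simp only [coe_filter, mem_univ, true_and, Set.mem_ofPred_eq] at hI hJ
    exact eq_of_pos_eq (hI.trans hJ.symm) h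
  have himg : ({J | c' J = β} : Finset (Fin k)).image (pos c') = range (colorCount c' β) := by
    refine eq_of_subset_of_card_le (fun j hj => ?_) ?_
    · obtain ⟨J, hJ, rfl⟩ := mem_image.1 hj
      simp only [mem_filter, mem_univ, true_and] at hJ
      exact mem_range.2 (hJ ▸ pos_lt_colorCount J)
    · rw [card_image_of_injOn hinj, card_range]; rfl
  rw [← himg, prod_image hinj]

lemma prod_color {M : Type*} [CommMonoid M] (c' : Fin k → Fin n) (f : Fin n → ℕ → M) :
    ∏ I, f (c' I) (pos c' I) = ∏ α, ∏ i ∈ range (colorCount c' α), f α i := by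
  rw [← prod_fiberwise_of_maps_to (g := c') (t := univ) (by simp)]
  refine prod_congr rfl fun α _ => ?_
  rw [← prod_filter_color]
  exact prod_congr rfl fun I hI => by rw [(mem_filter.1 hI).2]

end

/-- The genericity assumptions on the framing and mass parameters. -/
structure Generic (q₁ q₂ : ℂ) (a K : Fin n → ℂ) (c' : Fin k → Fin n) : Prop where
  norm_q₁ : 1 < ‖q₁‖
  norm_q₂ : 1 < ‖q₂‖
  a_ne : ∀ α, a α ≠ 0
  K_ne : ∀ α, K α ≠ 0
  anti : Antitone c'
  gen_a : ∀ (α β : Fin n) (s m : ℤ), |s| ≤ k → a α = a β * q₁ ^ s * q₂ ^ m → α = β ∧ s = 0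
  gen_K : ∀ (β : Fin n) (I : Fin k) (m : ℤ), K β * a β ≠ a (c' I) * q₁ ^ pos c' I * q₂ ^ m

namespace Generic
variable {q₁ q₂ : ℂ} {a K : Fin n → ℂ} {c' : Fin k → Fin n} (G : Generic q₁ q₂ a K c')
include G

lemma q₁_ne : q₁ ≠ 0 := norm_pos_iff.1 (zero_lt_one.trans G.norm_q₁)
lemma q₂_ne : q₂ ≠ 0 := norm_pos_iff.1 (zero_lt_one.trans G.norm_q₂)
lemma p_ne : q₂⁻¹ ≠ 0 := inv_ne_zero G.q₂_ne
lemma norm_p : ‖q₂⁻¹‖ < 1 := by rw [norm_inv]; exact inv_lt_one_of_one_lt₀ G.norm_q₂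

lemma pole_ne (ν : Fin k → ℕ) (I : Fin k) : pole q₁ q₂ a c' ν I ≠ 0 :=
  mul_ne_zero (mul_ne_zero (G.a_ne _) (pow_ne_zero _ G.q₁_ne)) (zpow_ne_zero _ G.q₂_ne)

/-- Coincidences modulo powers of `q₂` between the points `a_α q₁^s`. -/
lemma eq_of_zpow_eq {α β : Fin n} {s m : ℤ} (hs : |s| ≤ k)
    (h : q₁ ^ s * (a β / a α) * q₂⁻¹ ^ m = 1) : β = α ∧ s = 0 := by
  have := G.gen_a α β s (-m) hs ?_
  · exact ⟨this.1.symm, this.2⟩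
  · have hα := G.a_ne α
    rw [inv_zpow'] at h
    field_simp at h
    linear_combination -h

end Generic

section
variable {E : Type*} [NormedAddCommGroup E] [NormedSpace ℂ E] {x : E}

lemma differentiableAt_prod {ι : Type*} {s : Finset ι} {f : ι → E → ℂ}
    (h : ∀ i ∈ s, DifferentiableAt ℂ (f i) x) :
    DifferentiableAt ℂ (fun y => ∏ i ∈ s, f i y) x := by
  classical
  induction s using Finset.induction_on with
  | empty => simp
  | insert i s hi ih =>
    simp only [prod_insert hi]
    exact (h i (mem_insert_self i s)).fun_mul (ih fun j hj => h j (mem_insert_of_mem hj))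

lemma differentiableAt_div {f g : E → ℂ} (hf : DifferentiableAt ℂ f x)
    (hg : DifferentiableAt ℂ g x) (h0 : g x ≠ 0) : DifferentiableAt ℂ (fun y => f y / g y) x := by
  simp only [div_eq_mul_inv]
  exact hf.fun_mul (DifferentiableAt.comp (g := fun u : ℂ => u⁻¹) x (differentiableAt_inv h0) hg)

end

/-! ### The singular factors near a pole -/

/-- The symmetric factor of the integrand without its factors that are singular at `P`. -/
def regPart (q₁ q₂ : ℂ) (a K : Fin n → ℂ) (P x : Fin k → ℂ) : ℂ :=
  (∏ I, ∏ J ∈ univ.erase I,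
    qPochInf q₂⁻¹ (x J / x I) / qRed q₂⁻¹ (q₁ * (P J / P I)) (q₁ * (x J / x I))) *
  ∏ I, ∏ β, qPochInf q₂⁻¹ (K β * a β / x I) / qRed q₂⁻¹ (a β / P I) (a β / x I)

/-- The slope of the line `x_I = λ_I x_{I-1}` through the pole on which the integrand is singular;
it is `0` if `I` is the first index of its colour. -/
def chainSlope (c' : Fin k → Fin n) (P : Fin k → ℂ) (I : Fin k) : ℂ :=
  if pos c' I = 0 then 0 else P I / P (prevIdx I)

/-- Conditions on `y` under which all factors except the singular ones are regular at `y`. -/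
structure RegularAt (q₁ q₂ : ℂ) (a K : Fin n → ℂ) (P y : Fin k → ℂ) : Prop where
  ne_zero : ∀ I, y I ≠ 0
  theta_ne : ∀ I J, I ≠ J → theta q₂⁻¹ (y J / y I) ≠ 0
  theta_K_ne : ∀ I α, theta q₂⁻¹ (K α * a α / y I) ≠ 0
  qRed_ne : ∀ I J, I ≠ J → qRed q₂⁻¹ (q₁ * (P J / P I)) (q₁ * (y J / y I)) ≠ 0
  qRed_a_ne : ∀ I β, qRed q₂⁻¹ (a β / P I) (a β / y I) ≠ 0

lemma abs_pos_sub_le (c' : Fin k → Fin n) (I J : Fin k) :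
    |(pos c' J : ℤ) - pos c' I + 1| ≤ k := by
  have h1 := pos_lt (c' := c') I
  have h2 := pos_lt (c' := c') J
  rw [abs_le]; omega

namespace Generic
variable {q₁ q₂ : ℂ} {a K : Fin n → ℂ} {c' : Fin k → Fin n} (G : Generic q₁ q₂ a K c')
include G

lemma mul_pole_div_pole (ν : Fin k → ℕ) (I J : Fin k) (s : ℤ) :
    q₁ ^ s * (pole q₁ q₂ a c' ν J / pole q₁ q₂ a c' ν I) =
      q₁ ^ ((pos c' J : ℤ) - pos c' I + s) * (a (c' J) / a (c' I)) *
        q₂⁻¹ ^ ((ν J : ℤ) - ν I) := by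
  have h1 := G.q₁_ne
  have h2 := G.q₂_ne
  have h3 := G.a_ne (c' I)
  unfold pole
  rw [zpow_add₀ h1, zpow_sub₀ h1, inv_zpow', neg_sub, zpow_sub₀ h2, zpow_neg, zpow_neg]
  simp only [zpow_natCast]
  field_simp

lemma div_pole (ν : Fin k → ℕ) (I : Fin k) (β : Fin n) :
    a β / pole q₁ q₂ a c' ν I =
      q₁ ^ (-(pos c' I : ℤ)) * (a β / a (c' I)) * q₂⁻¹ ^ (-(ν I : ℤ)) := by
  have h1 := G.q₁_ne
  have h2 := G.q₂_ne
  have h3 := G.a_ne (c' I)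
  unfold pole
  rw [inv_zpow', neg_neg, zpow_neg, zpow_neg]
  simp only [zpow_natCast]
  field_simp

lemma exists_pole_div_iff (ν : InvPart c') (I J : Fin k) :
    (∃ m : ℕ, q₁ * (pole q₁ q₂ a c' ν.1 J / pole q₁ q₂ a c' ν.1 I) * q₂⁻¹ ^ m = 1) ↔
      c' J = c' I ∧ pos c' I = pos c' J + 1 := by
  have key := G.mul_pole_div_pole ν.1 I J 1
  rw [zpow_one] at key
  simp only [key]
  constructor
  · rintro ⟨m, hm⟩
    rw [mul_assoc, ← zpow_natCast, ← zpow_add₀ G.p_ne] at hm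
    have := G.eq_of_zpow_eq (abs_pos_sub_le c' I J) hm
    exact ⟨this.1, by omega⟩
  · rintro ⟨h, hp⟩
    have hν := ν.2 J I (lt_of_pos_lt h (by omega)).le h
    refine ⟨ν.1 I - ν.1 J, ?_⟩
    rw [mul_assoc, ← zpow_natCast, ← zpow_add₀ G.p_ne, h, hp,
      div_self (G.a_ne _)]
    push_cast [hν]
    ring_nf
    simp

lemma exists_div_pole_iff (ν : Fin k → ℕ) (I : Fin k) (β : Fin n) :
    (∃ m : ℕ, a β / pole q₁ q₂ a c' ν I * q₂⁻¹ ^ m = 1) ↔ β = c' I ∧ pos c' I = 0 := by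
  rw [G.div_pole]
  constructor
  · rintro ⟨m, hm⟩
    rw [mul_assoc, ← zpow_natCast, ← zpow_add₀ G.p_ne] at hm
    have := G.eq_of_zpow_eq (by have := pos_lt (c' := c') I; rw [abs_le]; omega) hm
    exact ⟨this.1, by omega⟩
  · rintro ⟨rfl, hp⟩
    refine ⟨ν I, ?_⟩
    rw [mul_assoc, ← zpow_natCast, ← zpow_add₀ G.p_ne, hp, div_self (G.a_ne _)]
    simp

lemma pole_div_pole_ne (ν : Fin k → ℕ) {I J : Fin k} (hIJ : I ≠ J) (m : ℤ) :
    pole q₁ q₂ a c' ν J / pole q₁ q₂ a c' ν I ≠ q₂⁻¹ ^ m := by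
  intro h
  have key := G.mul_pole_div_pole ν I J 0
  rw [zpow_zero, one_mul, add_zero, h] at key
  have h2 : q₁ ^ ((pos c' J : ℤ) - pos c' I) * (a (c' J) / a (c' I)) *
      q₂⁻¹ ^ ((ν J : ℤ) - ν I - m) = 1 := by
    rw [zpow_sub₀ G.p_ne, ← mul_div_assoc, ← key, div_self (zpow_ne_zero _ G.p_ne)]
  have h1 := pos_lt (c' := c') I
  have h3 := pos_lt (c' := c') J
  have := G.eq_of_zpow_eq (by rw [abs_le]; omega) h2
  exact hIJ (eq_of_pos_eq this.1 (by omega)).symm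

lemma K_div_pole_ne (ν : Fin k → ℕ) (I : Fin k) (β : Fin n) (m : ℤ) :
    K β * a β / pole q₁ q₂ a c' ν I ≠ q₂⁻¹ ^ m := by
  intro h
  refine G.gen_K β I (-(ν I : ℤ) - m) ?_
  rw [div_eq_iff (G.pole_ne ν I)] at h
  rw [h, pole, zpow_sub₀ G.q₂_ne, inv_zpow]
  ring

/-- The singular factors are the linear forms that vanish at the pole along a chain of boxes. -/
lemma prod_qLin_eq (ν : InvPart c') {y : Fin k → ℂ} (hy : ∀ I, y I ≠ 0) :
    ((∏ I, ∏ J ∈ univ.erase I, qLin q₂⁻¹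
        (q₁ * (pole q₁ q₂ a c' ν.1 J / pole q₁ q₂ a c' ν.1 I)) (q₁ * (y J / y I))) *
      ∏ I, ∏ β, qLin q₂⁻¹ (a β / pole q₁ q₂ a c' ν.1 I) (a β / y I)) * ∏ I, y I =
    chainDen (pole q₁ q₂ a c' ν.1) (chainSlope c' (pole q₁ q₂ a c' ν.1)) 0 y := by
  have hP := G.pole_ne ν.1
  set P := pole q₁ q₂ a c' ν.1 with hPdef
  unfold chainDen
  rw [← prod_mul_distrib, ← prod_mul_distrib]
  refine prod_congr rfl fun I _ => ?_
  have hq : ∀ J, qLin q₂⁻¹ (q₁ * (P J / P I)) (q₁ * (y J / y I)) =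
      if c' J = c' I ∧ pos c' I = pos c' J + 1 then
        1 - q₁ * (y J / y I) / (q₁ * (P J / P I)) else 1 := by
    intro J
    unfold qLin
    simp only [hPdef, G.exists_pole_div_iff ν I J]
  have hf : ∀ β, qLin q₂⁻¹ (a β / P I) (a β / y I) =
      if β = c' I ∧ pos c' I = 0 then 1 - a β / y I / (a β / P I) else 1 := by
    intro β
    unfold qLin
    simp only [hPdef, G.exists_div_pole_iff ν.1 I β]
  simp only [hq, hf]
  have hyI := hy I
  have hPI := hP I
  by_cases h0 : pos c' I = 0
  · rw [prod_eq_one fun J _ => if_neg (by omega), chainSlope, if_pos h0,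
      prod_eq_single (c' I) (fun β _ hβ => if_neg (by tauto)) (by simp), if_pos ⟨rfl, h0⟩]
    have := G.a_ne (c' I)
    field_simp
    ring
  · obtain ⟨hI0, hcol, hpos⟩ := pos_prevIdx G.anti h0
    have hcast : I.castSucc = (prevIdx I).succ := by
      simp only [prevIdx, Fin.ext_iff, Fin.val_castSucc, Fin.val_succ]; omega
    rw [prod_eq_one (s := univ) fun β _ => if_neg (by tauto), chainSlope, if_neg h0, hcast,
      Fin.cons_succ, prod_eq_single_of_mem (prevIdx I), if_pos ⟨hcol, hpos⟩]
    · have h1 := hP (prevIdx I)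
      have h2 := G.q₁_ne
      field_simp
      ring
    · rw [mem_erase]
      refine ⟨fun h => ?_, mem_univ _⟩
      rw [h] at hpos
      omega
    · intro J _ hJ
      exact if_neg fun h => hJ (eq_prevIdx G.anti h.1 h.2)

lemma screeningPart_div_prod (ν : InvPart c') {y : Fin k → ℂ} (hy : ∀ I, y I ≠ 0) :
    screeningPart q₁ q₂ a K y / ∏ I, y I =
      regPart q₁ q₂ a K (pole q₁ q₂ a c' ν.1) y /
        chainDen (pole q₁ q₂ a c' ν.1) (chainSlope c' (pole q₁ q₂ a c' ν.1)) 0 y := by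
  rw [← G.prod_qLin_eq ν hy, screeningPart, regPart]
  have h1 : ∀ I J, qPochInf q₂⁻¹ (q₁ * (y J / y I)) =
      qLin q₂⁻¹ (q₁ * (pole q₁ q₂ a c' ν.1 J / pole q₁ q₂ a c' ν.1 I)) (q₁ * (y J / y I)) *
      qRed q₂⁻¹ (q₁ * (pole q₁ q₂ a c' ν.1 J / pole q₁ q₂ a c' ν.1 I)) (q₁ * (y J / y I)) :=
    fun I J => qPochInf_eq_mul_qRed G.p_ne G.norm_p _ _
  have h2 : ∀ I β, qPochInf q₂⁻¹ (a β / y I) =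
      qLin q₂⁻¹ (a β / pole q₁ q₂ a c' ν.1 I) (a β / y I) *
      qRed q₂⁻¹ (a β / pole q₁ q₂ a c' ν.1 I) (a β / y I) :=
    fun I β => qPochInf_eq_mul_qRed G.p_ne G.norm_p _ _
  simp only [prod_div_distrib, h1, h2, prod_mul_distrib]
  simp only [div_eq_mul_inv, mul_inv]
  ring

lemma regularAt_pole (ν : InvPart c') :
    RegularAt q₁ q₂ a K (pole q₁ q₂ a c' ν.1) (pole q₁ q₂ a c' ν.1) where
  ne_zero := G.pole_ne ν.1
  theta_ne _ _ hIJ := theta_ne_zero G.p_ne G.norm_p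
    (div_ne_zero (G.pole_ne _ _) (G.pole_ne _ _)) (G.pole_div_pole_ne _ hIJ)
  theta_K_ne I α := theta_ne_zero G.p_ne G.norm_p
    (div_ne_zero (mul_ne_zero (G.K_ne α) (G.a_ne α)) (G.pole_ne _ _)) (G.K_div_pole_ne _ I α)
  qRed_ne _ _ _ := qReg_ne_zero G.norm_p _
  qRed_a_ne _ _ := qReg_ne_zero G.norm_p _

lemma eventually_regularAt (ν : InvPart c') :
    ∀ᶠ y in nhds (pole q₁ q₂ a c' ν.1), RegularAt q₁ q₂ a K (pole q₁ q₂ a c' ν.1) y := by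
  have hP := G.pole_ne ν.1
  have hreg := G.regularAt_pole ν
  set P := pole q₁ q₂ a c' ν.1
  have hap : ∀ I, ContinuousAt (fun y : Fin k → ℂ => y I) P :=
    fun I => (continuous_apply I).continuousAt
  have hdiv : ∀ I J, ContinuousAt (fun y : Fin k → ℂ => y J / y I) P :=
    fun I J => (hap J).div (hap I) (hP I)
  have hth : ∀ (f : (Fin k → ℂ) → ℂ), ContinuousAt f P → f P ≠ 0 →
      ContinuousAt (fun y => theta q₂⁻¹ (f y)) P := fun f hf h0 =>
    ContinuousAt.comp (f := f) (g := theta q₂⁻¹) (differentiableAt_theta G.norm_p h0).continuousAt hf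
  have hqr : ∀ (u : ℂ) (f : (Fin k → ℂ) → ℂ), ContinuousAt f P →
      ContinuousAt (fun y => qRed q₂⁻¹ u (f y)) P := fun u f hf =>
    ContinuousAt.comp (f := f) (g := qRed q₂⁻¹ u)
      (differentiable_qRed G.norm_p u _).continuousAt hf
  have e1 : ∀ᶠ y in nhds P, ∀ I, y I ≠ 0 :=
    Filter.eventually_all.2 fun I => (hap I).eventually_ne (hP I)
  have e2 : ∀ᶠ y in nhds P, ∀ I J, I ≠ J → theta q₂⁻¹ (y J / y I) ≠ 0 := by
    refine Filter.eventually_all.2 fun I => Filter.eventually_all.2 fun J => ?_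
    by_cases hIJ : I = J
    · exact .of_forall fun y h => absurd hIJ h
    · filter_upwards [(hth _ (hdiv I J) (div_ne_zero (hP J) (hP I))).eventually_ne
        (hreg.theta_ne _ _ hIJ)] with y hy _ using hy
  have e3 : ∀ᶠ y in nhds P, ∀ I α, theta q₂⁻¹ (K α * a α / y I) ≠ 0 := by
    refine Filter.eventually_all.2 fun I => Filter.eventually_all.2 fun α => ?_
    refine (hth _ (continuousAt_const.div (hap I) (hP I)) ?_).eventually_ne (hreg.theta_K_ne I α)
    exact div_ne_zero (mul_ne_zero (G.K_ne α) (G.a_ne α)) (hP I)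
  have e4 : ∀ᶠ y in nhds P, ∀ I J, I ≠ J →
      qRed q₂⁻¹ (q₁ * (P J / P I)) (q₁ * (y J / y I)) ≠ 0 := by
    refine Filter.eventually_all.2 fun I => Filter.eventually_all.2 fun J => ?_
    by_cases hIJ : I = J
    · exact .of_forall fun y h => absurd hIJ h
    · filter_upwards [(hqr (q₁ * (P J / P I)) _ (continuousAt_const.mul (hdiv I J))).eventually_ne
        (hreg.qRed_ne I J hIJ)] with y hy _ using hy
  have e5 : ∀ᶠ y in nhds P, ∀ I β, qRed q₂⁻¹ (a β / P I) (a β / y I) ≠ 0 := by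
    refine Filter.eventually_all.2 fun I => Filter.eventually_all.2 fun β => ?_
    exact (hqr (a β / P I) _ (continuousAt_const.div (hap I) (hP I))).eventually_ne
      (hreg.qRed_a_ne I β)
  filter_upwards [e1, e2, e3, e4, e5] with y h1 h2 h3 h4 h5 using ⟨h1, h2, h3, h4, h5⟩

lemma differentiableAt_regPart {P y : Fin k → ℂ} (hy : RegularAt q₁ q₂ a K P y) :
    DifferentiableAt ℂ (regPart q₁ q₂ a K P) y := by
  have hap : ∀ I, DifferentiableAt ℂ (fun y : Fin k → ℂ => y I) y := fun I => by fun_prop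
  have hE : ∀ (f : (Fin k → ℂ) → ℂ), DifferentiableAt ℂ f y →
      DifferentiableAt ℂ (fun y => qPochInf q₂⁻¹ (f y)) y := fun f hf =>
    DifferentiableAt.comp (f := f) (g := qPochInf q₂⁻¹) y (differentiable_qPochInf G.norm_p _) hf
  have hR : ∀ (u : ℂ) (f : (Fin k → ℂ) → ℂ), DifferentiableAt ℂ f y →
      DifferentiableAt ℂ (fun y => qRed q₂⁻¹ u (f y)) y := fun u f hf =>
    DifferentiableAt.comp (f := f) (g := qRed q₂⁻¹ u) y (differentiable_qRed G.norm_p u _) hf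
  unfold regPart
  refine DifferentiableAt.fun_mul ?_ ?_
  · refine differentiableAt_prod fun I _ => ?_
    refine differentiableAt_prod fun J hJ => ?_
    have hd := differentiableAt_div (hap J) (hap I) (hy.ne_zero I)
    exact differentiableAt_div (hE _ hd) (hR _ _ (hd.const_mul q₁))
      (hy.qRed_ne I J (ne_of_mem_erase hJ).symm)
  · refine differentiableAt_prod fun I _ => ?_
    refine differentiableAt_prod fun β _ => ?_
    have hd : ∀ u : ℂ, DifferentiableAt ℂ (fun y : Fin k → ℂ => u / y I) y := fun u =>
      differentiableAt_div (differentiableAt_const u) (hap I) (hy.ne_zero I)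
    exact differentiableAt_div (hE _ (hd _)) (hR _ _ (hd _)) (hy.qRed_a_ne I β)

lemma differentiableAt_stabTerm {z : ℂ} {c : Fin k → Fin n} {P y : Fin k → ℂ} (hz : z ≠ 0)
    (hy : RegularAt q₁ q₂ a K P y) (w : Equiv.Perm (Fin k)) :
    DifferentiableAt ℂ (fun y => stabTerm q₁ q₂ z a K c (y ∘ w)) y := by
  have hap : ∀ I, DifferentiableAt ℂ (fun y : Fin k → ℂ => y I) y := fun I => by fun_prop
  have hth : ∀ (f : (Fin k → ℂ) → ℂ), DifferentiableAt ℂ f y → f y ≠ 0 →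
      DifferentiableAt ℂ (fun y => theta q₂⁻¹ (f y)) y := fun f hf h0 =>
    DifferentiableAt.comp (f := f) (g := theta q₂⁻¹) y (differentiableAt_theta G.norm_p h0) hf
  have hcd : ∀ (u : ℂ) (I : Fin k), u ≠ 0 →
      DifferentiableAt ℂ (fun y : Fin k → ℂ => theta q₂⁻¹ (u / y I)) y := fun u I hu =>
    hth (fun y => u / y I) (differentiableAt_div (differentiableAt_const u) (hap I) (hy.ne_zero I))
      (div_ne_zero hu (hy.ne_zero I))
  have hKa : ∀ α, K α * a α ≠ 0 := fun α => mul_ne_zero (G.K_ne α) (G.a_ne α)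
  unfold stabTerm
  simp only [Function.comp_apply]
  refine DifferentiableAt.fun_mul ?_ ?_
  · refine differentiableAt_prod fun i _ => ?_
    refine differentiableAt_prod fun j hj => ?_
    have hi := hy.ne_zero (w i)
    have hj' := hy.ne_zero (w j)
    refine differentiableAt_div (hth _ (differentiableAt_div ((hap (w j)).const_mul q₁) (hap (w i)) hi)
      (div_ne_zero (mul_ne_zero G.q₁_ne hj') hi))
      (hth _ (differentiableAt_div (hap (w j)) (hap (w i)) hi) (div_ne_zero hj' hi)) ?_
    exact hy.theta_ne _ _ fun h => (mem_Ioi.1 hj).ne (w.injective h)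
  · refine differentiableAt_prod fun i _ => differentiableAt_div ?_ ?_ ?_
    · refine (DifferentiableAt.fun_mul ?_ ?_).fun_mul ?_
      · exact differentiableAt_prod fun α _ => hcd _ _ (G.a_ne α)
      · exact hcd _ _ (mul_ne_zero (mul_ne_zero (mul_ne_zero hz (zpow_ne_zero _ G.q₁_ne))
          (prod_ne_zero_iff.2 fun α _ => G.K_ne α)) (G.a_ne _))
      · exact differentiableAt_prod fun α _ => hcd _ _ (hKa α)
    · exact differentiableAt_prod fun α _ => hcd _ _ (hKa α)
    · exact prod_ne_zero_iff.2 fun α _ => hy.theta_K_ne (w i) α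

/-- The contribution of the pole is the value at the pole of the symmetrised regular part of the
integrand.
Cauchy's formula is applied to each of the `k!` relabellings, brought to the same torus. -/
theorem hasPoleContribution {z : ℂ} (hz : z ≠ 0) (c : Fin k → Fin n) (ν : InvPart c') :
    HasPoleContribution q₁ q₂ a c' (blockIntegrand q₁ q₂ z a K c) ν.1
      (blockConst q₁ q₂ z K c * offShellStab q₁ q₂ z a K c (pole q₁ q₂ a c' ν.1) *
        regPart q₁ q₂ a K (pole q₁ q₂ a c' ν.1) (pole q₁ q₂ a c' ν.1)) := by
  have hev := G.eventually_regularAt ν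
  have hPne := G.pole_ne ν.1
  set P := pole q₁ q₂ a c' ν.1 with hP
  obtain ⟨ε, hε, hball⟩ := Metric.eventually_nhds_iff.1 hev
  refine ⟨ε, hε, fun R hR hadm => ?_⟩
  have hR0 : ∀ I, 0 < R I := fun I => (hR I).1
  have hgood : ∀ y : Fin k → ℂ, (∀ I, ‖y I - P I‖ ≤ R I) → RegularAt q₁ q₂ a K P y := by
    refine fun y hy => hball ((dist_pi_lt_iff hε).2 fun I => ?_)
    rw [dist_eq_norm]
    exact (hy I).trans_lt (hR I).2
  -- admissibility of the radii is the condition that each circle encircles its singular point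
  have hlam : ∀ I, ‖chainSlope c' P I‖ *
      (Fin.cons ‖(0 : ℂ)‖ R : Fin (k + 1) → ℝ) I.castSucc < R I := by
    intro I
    unfold chainSlope
    split_ifs with h0
    · simpa using hR0 I
    · obtain ⟨hI0, hcol, hpos⟩ := pos_prevIdx G.anti h0
      have hcast : I.castSucc = (prevIdx I).succ := by
        simp only [prevIdx, Fin.ext_iff, Fin.val_castSucc, Fin.val_succ]; omega
      rw [hcast, Fin.cons_succ]
      convert hadm _ _ hcol hpos using 3
      have := G.mul_pole_div_pole ν.1 (prevIdx I) I 0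
      rw [zpow_zero, one_mul] at this
      rw [hP, this, hpos, hcol, div_self (G.a_ne _), inv_zpow', neg_sub]
      push_cast
      ring_nf
      simp [mul_comm]
  set H : Equiv.Perm (Fin k) → (Fin k → ℂ) → ℂ := fun w y =>
    blockConst q₁ q₂ z K c * stabTerm q₁ q₂ z a K c (y ∘ w) * regPart q₁ q₂ a K P y with hH
  have hHdiff : ∀ w, ∀ y : Fin k → ℂ, (∀ I, ‖y I - P I‖ ≤ R I) → DifferentiableAt ℂ (H w) y :=
    fun w y hy => ((G.differentiableAt_stabTerm hz (hgood y hy) w).const_mul _).mul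
      (G.differentiableAt_regPart (hgood y hy))
  have hint : ∀ (w : Equiv.Perm (Fin k)) (θ : Fin k → ℝ),
      blockIntegrand q₁ q₂ z a K c (torusMap P R θ ∘ w) / ∏ i, (torusMap P R θ ∘ w) i =
      H w (torusMap P R θ) / chainDen P (chainSlope c' P) 0 (torusMap P R θ) := by
    intro w θ
    have hnorm := norm_torusMap_sub (P := P) hR0 θ
    generalize torusMap P R θ = y at hnorm ⊢
    have hy := hgood y fun I => (hnorm I).le
    have hne := chainDen_ne_zero hlam hnorm
    rw [hP, ← G.prod_qLin_eq ν hy.ne_zero, ← hP] at hne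
    have hlin1 := prod_ne_zero_iff.1 (left_ne_zero_of_mul (left_ne_zero_of_mul hne))
    have hlin2 := prod_ne_zero_iff.1 (right_ne_zero_of_mul (left_ne_zero_of_mul hne))
    have hx := hy.ne_zero
    rw [blockIntegrand_eq G.q₁_ne G.a_ne G.K_ne (x := y ∘ w) (fun i => hx _)
      (fun i j hij => qPochInf_ne_zero_of_theta (hy.theta_ne _ _ (w.injective.ne hij)))
      (fun i j hij => ?_) (fun i α => ?_) (fun i α => hy.theta_K_ne _ α),
      screeningPart_comp_perm, mul_div_assoc]
    · have : ∏ i, (y ∘ w) i = ∏ i, y i := Equiv.prod_comp w y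
      rw [this, G.screeningPart_div_prod ν hx, hH, mul_div_assoc]
    · have hne' := w.injective.ne hij
      simp only [Function.comp_apply]
      rw [qPochInf_eq_mul_qRed G.p_ne G.norm_p (q₁ * (P (w j) / P (w i)))]
      exact mul_ne_zero (prod_ne_zero_iff.1 (hlin1 (w i) (mem_univ _)) (w j)
        (mem_erase.2 ⟨hne'.symm, mem_univ _⟩)) (hy.qRed_ne _ _ hne')
    · simp only [Function.comp_apply]
      rw [qPochInf_eq_mul_qRed G.p_ne G.norm_p (a α / P (w i))]
      exact mul_ne_zero (prod_ne_zero_iff.1 (hlin2 (w i) (mem_univ _)) α (mem_univ _))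
        (hy.qRed_a_ne _ _)
  refine ⟨fun w => torusIntegrable_comp_perm w ?_, ?_⟩
  · have := torusIntegrable_div_chainDen hR0 hlam (hHdiff w)
    change TorusIntegrable _ P R
    unfold TorusIntegrable at this ⊢
    simpa only [hint] using this
  · have hval : ∀ w : Equiv.Perm (Fin k), (2 * (Real.pi : ℂ) * Complex.I)⁻¹ ^ k *
        torusIntegral (fun x => blockIntegrand q₁ q₂ z a K c x / ∏ i, x i) (P ∘ w) (R ∘ w) =
        H w P := by
      intro w
      rw [torusIntegral_comp_perm]
      have h1 := (torusIntegral_div_chainDen hR0 hlam (hHdiff w)).2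
      simp only [zero_mul, add_zero] at h1
      have h2 : torusIntegral (fun y => blockIntegrand q₁ q₂ z a K c (y ∘ w) / ∏ i, (y ∘ w) i) P R
          = torusIntegral (fun y => H w y / chainDen P (chainSlope c' P) 0 y) P R := by
        unfold torusIntegral
        simp only [hint]
      rw [h2, h1, ← mul_assoc, ← mul_pow, inv_mul_cancel₀ Complex.two_pi_I_ne_zero, one_pow,
        one_mul]
    rw [sum_congr rfl fun w _ => hval w]
    simp only [hH, offShellStab, mul_sum, sum_mul]

end Generic

/-! ### The value of the regular part at a pole -/

lemma prod_range_div_succ {f : ℕ → ℂ} (hf : ∀ i, f i ≠ 0) (l : ℕ) :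
    ∏ i ∈ range l, f i / f (i + 1) = f 0 / f l := by
  induction l with
  | zero => simp [hf 0]
  | succ l ih =>
    rw [prod_range_succ, ih]
    have := hf l
    field_simp

namespace Generic
variable {q₁ q₂ : ℂ} {a K : Fin n → ℂ} {c' : Fin k → Fin n} (G : Generic q₁ q₂ a K c')
include G

lemma zpow_eq_one {l : ℤ} (h : q₂⁻¹ ^ l = 1) : l = 0 := by
  by_contra hl
  have h2 := congrArg norm h
  rw [norm_zpow, norm_one] at h2
  rcases lt_or_gt_of_ne hl with h0 | h0
  · exact absurd h2 (one_lt_zpow_of_neg₀ (norm_pos_iff.2 G.p_ne) G.norm_p h0).ne'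
  · exact absurd h2 (zpow_lt_one₀ (norm_pos_iff.2 G.p_ne) G.norm_p h0).ne

lemma pair_ne_one {I J : Fin k} (hIJ : I ≠ J) (l : ℤ) :
    q₁ ^ ((pos c' J : ℤ) - pos c' I) * (a (c' J) / a (c' I)) * q₂⁻¹ ^ l ≠ 1 := by
  intro h
  have h1 := pos_lt (c' := c') I
  have h2 := pos_lt (c' := c') J
  have := G.eq_of_zpow_eq (by rw [abs_le]; omega) h
  exact hIJ (eq_of_pos_eq this.1 (by omega)).symm

lemma K_ne_one (I : Fin k) (β : Fin n) (l : ℤ) :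
    q₁ ^ (-(pos c' I : ℤ)) * K β * (a β / a (c' I)) * q₂⁻¹ ^ l ≠ 1 := by
  intro h
  refine G.gen_K β I l ?_
  have h1 := G.q₁_ne
  have h2 := zpow_ne_zero l G.q₂_ne
  have h3 := G.a_ne (c' I)
  rw [zpow_neg, zpow_natCast, inv_zpow] at h
  field_simp at h
  linear_combination h

/-- The vortex part collects the effect of the shifts by powers of `q₂` on all regularised
infinite products. -/
lemma regPart_pole_eq (ν : InvPart c') :
    regPart q₁ q₂ a K (pole q₁ q₂ a c' ν.1) (pole q₁ q₂ a c' ν.1) =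
      ((∏ I, ∏ J ∈ univ.erase I,
        qReg q₂⁻¹ (q₁ ^ ((pos c' J : ℤ) - pos c' I) * (a (c' J) / a (c' I))) /
          qReg q₂⁻¹ (q₁ ^ ((pos c' J : ℤ) - pos c' I + 1) * (a (c' J) / a (c' I)))) *
      ∏ I, ∏ β, qReg q₂⁻¹ (q₁ ^ (-(pos c' I : ℤ)) * K β * (a β / a (c' I))) /
        qReg q₂⁻¹ (q₁ ^ (-(pos c' I : ℤ)) * (a β / a (c' I)))) *
      vortexPart q₁ q₂ a K c' ν.1 := by
  have hne := fun u => qReg_ne_zero G.norm_p u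
  have hdiv : ∀ {A A' B B' X Y : ℂ}, A ≠ 0 → A' ≠ 0 → A = X * A' → B = Y * B' → B ≠ 0 →
      A' / B' = A / B * (Y / X) := by
    rintro A A' B B' X Y h1 h2 rfl rfl h3
    have hX := left_ne_zero_of_mul h1
    have hY := left_ne_zero_of_mul h3
    have hB := right_ne_zero_of_mul h3
    field_simp
  unfold regPart vortexPart
  rw [mul_mul_mul_comm]
  congr 1
  · rw [← prod_mul_distrib]
    refine prod_congr rfl fun I _ => ?_
    rw [← prod_mul_distrib]
    refine prod_congr rfl fun J hJ => ?_
    have hIJ : I ≠ J := (ne_of_mem_erase hJ).symm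
    have e0 := G.mul_pole_div_pole ν.1 I J 0
    rw [zpow_zero, one_mul, add_zero] at e0
    have e1 := G.mul_pole_div_pole ν.1 I J 1
    rw [zpow_one] at e1
    rw [← qReg_eq_qPochInf fun m hm => ?_, ← qReg, e1, e0]
    · refine hdiv (hne _) (hne _) ?_ ?_ (hne _)
      · exact qReg_eq_qPoch_mul G.p_ne G.norm_p fun l _ => G.pair_ne_one hIJ l
      · refine qReg_eq_qPoch_mul G.p_ne G.norm_p fun l hl h => ?_
        obtain ⟨hcol, hs⟩ := G.eq_of_zpow_eq (abs_pos_sub_le c' I J) h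
        rw [hcol, hs, div_self (G.a_ne _), zpow_zero, one_mul, one_mul] at h
        have := ν.2 J I (lt_of_pos_lt hcol (by omega)).le hcol
        have := G.zpow_eq_one h
        omega
    · refine G.pole_div_pole_ne ν.1 hIJ (-(m : ℤ)) ?_
      rw [zpow_neg, zpow_natCast]
      exact eq_inv_of_mul_eq_one_left hm
  · rw [← prod_mul_distrib]
    refine prod_congr rfl fun I _ => ?_
    rw [← prod_mul_distrib]
    refine prod_congr rfl fun β _ => ?_
    have e0 : K β * a β / pole q₁ q₂ a c' ν.1 I =
        q₁ ^ (-(pos c' I : ℤ)) * K β * (a β / a (c' I)) * q₂⁻¹ ^ (-(ν.1 I : ℤ)) := by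
      rw [mul_div_assoc, G.div_pole]; ring
    rw [← qReg_eq_qPochInf fun m hm => ?_, ← qReg, e0, G.div_pole]
    · refine hdiv (hne _) (hne _) ?_ ?_ (hne _)
      · exact qReg_eq_qPoch_mul G.p_ne G.norm_p fun l _ => G.K_ne_one I β l
      · refine qReg_eq_qPoch_mul G.p_ne G.norm_p fun l hl h => ?_
        obtain ⟨hcol, hs⟩ := G.eq_of_zpow_eq
          (by have := pos_lt (c' := c') I; rw [abs_le]; omega) h
        rw [hcol, hs, div_self (G.a_ne _), zpow_zero, one_mul, one_mul] at h
        have := G.zpow_eq_one h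
        omega
    · refine G.K_div_pole_ne ν.1 I β (-(m : ℤ)) ?_
      rw [zpow_neg, zpow_natCast]
      exact eq_inv_of_mul_eq_one_left hm

/-- The products along the columns of boxes telescope. -/
lemma prod_qReg_eq_pertPart :
    ((∏ I, ∏ J ∈ univ.erase I,
        qReg q₂⁻¹ (q₁ ^ ((pos c' J : ℤ) - pos c' I) * (a (c' J) / a (c' I))) /
          qReg q₂⁻¹ (q₁ ^ ((pos c' J : ℤ) - pos c' I + 1) * (a (c' J) / a (c' I)))) *
      ∏ I, ∏ β, qReg q₂⁻¹ (q₁ ^ (-(pos c' I : ℤ)) * K β * (a β / a (c' I))) /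
        qReg q₂⁻¹ (q₁ ^ (-(pos c' I : ℤ)) * (a β / a (c' I)))) =
      pertPart q₁ q₂ a K c' := by
  have hne := fun u => qReg_ne_zero G.norm_p u
  have hp : qReg q₂⁻¹ 1 = qPochInf q₂⁻¹ q₂⁻¹ := by
    rw [qReg_eq_mul_qReg G.norm_p, if_pos rfl, one_mul, one_mul, qReg_eq_qPochInf]
    intro m hm
    rw [← pow_succ', ← zpow_natCast] at hm
    have := G.zpow_eq_one hm
    omega
  have hq : ∀ I : Fin k, qReg q₂⁻¹ q₁ = qPochInf q₂⁻¹ q₁ := by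
    intro I
    refine qReg_eq_qPochInf fun m hm => ?_
    have := G.eq_of_zpow_eq (α := c' I) (β := c' I) (s := 1) (m := m)
      (by have := I.2; rw [abs_le]; omega)
      (by rw [div_self (G.a_ne _), zpow_one, mul_one, zpow_natCast, hm])
    omega
  -- the products over `J` and `β` for a fixed box `I`
  have hI : ∀ I, (∏ J ∈ univ.erase I,
        qReg q₂⁻¹ (q₁ ^ ((pos c' J : ℤ) - pos c' I) * (a (c' J) / a (c' I))) /
          qReg q₂⁻¹ (q₁ ^ ((pos c' J : ℤ) - pos c' I + 1) * (a (c' J) / a (c' I)))) *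
      ∏ β, (qReg q₂⁻¹ (q₁ ^ (-(pos c' I : ℤ)) * (a β / a (c' I))))⁻¹ =
      qPochInf q₂⁻¹ q₁ / qPochInf q₂⁻¹ q₂⁻¹ *
        ∏ β, (qReg q₂⁻¹ (q₁ ^ ((colorCount c' β : ℤ) - pos c' I) * (a β / a (c' I))))⁻¹ := by
    intro I
    set g : Fin n → ℕ → ℂ := fun β j =>
      qReg q₂⁻¹ (q₁ ^ ((j : ℤ) - pos c' I) * (a β / a (c' I))) with hg
    have hsucc : ∀ J : Fin k,
        qReg q₂⁻¹ (q₁ ^ ((pos c' J : ℤ) - pos c' I + 1) * (a (c' J) / a (c' I))) =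
          g (c' J) (pos c' J + 1) := by
      intro J
      simp only [hg]
      push_cast
      ring_nf
    have hall : ∏ J, g (c' J) (pos c' J) / g (c' J) (pos c' J + 1) =
        (∏ β, g β 0) / ∏ β, g β (colorCount c' β) := by
      rw [← prod_div_distrib, prod_color c' fun β j => g β j / g β (j + 1)]
      exact prod_congr rfl fun β _ => prod_range_div_succ (fun j => hne _) _
    have hIfac : g (c' I) (pos c' I) / g (c' I) (pos c' I + 1) =
        qPochInf q₂⁻¹ q₂⁻¹ / qPochInf q₂⁻¹ q₁ := by
      simp only [hg]
      push_cast
      rw [sub_self, add_sub_cancel_left, zpow_zero, zpow_one, div_self (G.a_ne _), mul_one,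
        mul_one, hp, hq I]
    rw [← mul_prod_erase univ _ (mem_univ I), hIfac] at hall
    have hg0 : ∏ β, g β 0 ≠ 0 := prod_ne_zero_iff.2 fun β _ => hne _
    have h1 : qPochInf q₂⁻¹ q₁ ≠ 0 := hq I ▸ hne _
    have h2 : qPochInf q₂⁻¹ q₂⁻¹ ≠ 0 := hp ▸ hne _
    have hz : ∀ β, qReg q₂⁻¹ (q₁ ^ (-(pos c' I : ℤ)) * (a β / a (c' I))) = g β 0 := by
      intro β; simp [hg]
    simp only [hsucc, hz, prod_inv_distrib]
    change (∏ J ∈ univ.erase I, g (c' J) (pos c' J) / g (c' J) (pos c' J + 1)) * _ =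
      _ * (∏ β, g β (colorCount c' β))⁻¹
    have hgl : ∏ β, g β (colorCount c' β) ≠ 0 := prod_ne_zero_iff.2 fun β _ => hne _
    generalize ∏ J ∈ univ.erase I, g (c' J) (pos c' J) / g (c' J) (pos c' J + 1) = A at hall ⊢
    generalize ∏ β, g β 0 = C at *
    generalize ∏ β, g β (colorCount c' β) = D at *
    generalize qPochInf q₂⁻¹ q₁ = Q at *
    generalize qPochInf q₂⁻¹ q₂⁻¹ = E at *
    field_simp at hall ⊢
    linear_combination hall
  have hrefl : ∏ I, ∏ β, (qReg q₂⁻¹ (q₁ ^ ((colorCount c' β : ℤ) - pos c' I) *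
        (a β / a (c' I))))⁻¹ =
      ∏ I, ∏ β, (qPochInf q₂⁻¹ (a β / a (c' I) *
        q₁ ^ ((colorCount c' β : ℤ) - colorCount c' (c' I) + (pos c' I + 1))))⁻¹ := by
    rw [prod_color c' fun α i =>
      ∏ β, (qReg q₂⁻¹ (q₁ ^ ((colorCount c' β : ℤ) - i) * (a β / a α)))⁻¹]
    trans ∏ α, ∏ i ∈ range (colorCount c' α), ∏ β, (qReg q₂⁻¹ (a β / a α *
        q₁ ^ ((colorCount c' β : ℤ) - colorCount c' α + (i + 1))))⁻¹
    · refine prod_congr rfl fun α _ => ?_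
      rw [← prod_range_reflect]
      refine prod_congr rfl fun i hi => prod_congr rfl fun β _ => ?_
      have := mem_range.1 hi
      rw [mul_comm (a β / a α)]
      congr 4
      omega
    · rw [← prod_color c' fun α i => ∏ β, (qReg q₂⁻¹ (a β / a α *
        q₁ ^ ((colorCount c' β : ℤ) - colorCount c' α + (i + 1))))⁻¹]
      refine prod_congr rfl fun I _ => prod_congr rfl fun β _ => ?_
      rw [qReg_eq_qPochInf]
      intro m hm
      have h1 := pos_lt_colorCount (c' := c') I
      have h2 := colorCount_le c' (c' I)
      have h3 := colorCount_le c' β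
      rw [mul_comm (a β / a (c' I)), ← zpow_natCast] at hm
      obtain ⟨rfl, hs⟩ := G.eq_of_zpow_eq (by rw [abs_le]; omega) hm
      omega
  unfold pertPart
  have hcomb := prod_congr (rfl : (univ : Finset (Fin k)) = univ) fun I _ => hI I
  rw [prod_mul_distrib, prod_mul_distrib, hrefl, prod_const, card_fin] at hcomb
  have hK : ∀ I β, qReg q₂⁻¹ (q₁ ^ (-(pos c' I : ℤ)) * K β * (a β / a (c' I))) =
      qPochInf q₂⁻¹ (K β * (a β / a (c' I)) * q₁ ^ (-(pos c' I : ℤ))) := by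
    intro I β
    rw [qReg_eq_qPochInf fun m hm => G.K_ne_one I β m (by rw [zpow_natCast, hm])]
    ring_nf
  simp only [prod_div_distrib, prod_inv_distrib, div_pow, hK] at hcomb ⊢
  linear_combination (∏ I, ∏ β, qPochInf q₂⁻¹
    (K β * (a β / a (c' I)) * q₁ ^ (-(pos c' I : ℤ)))) * hcomb

lemma regPart_pole (ν : InvPart c') :
    regPart q₁ q₂ a K (pole q₁ q₂ a c' ν.1) (pole q₁ q₂ a c' ν.1) =
      pertPart q₁ q₂ a K c' * vortexPart q₁ q₂ a K c' ν.1 := by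
  rw [G.regPart_pole_eq, G.prod_qReg_eq_pertPart]

end Generic

/-! ### The elliptic stable envelope -/

/-- The `i`-th factor of the stable envelope is `∏_α θ(v_α / x_i) / θ(K_α a_α / x_i)` with these
`v_α`. -/
def stabWeight (q₁ z : ℂ) (a K : Fin n → ℂ) (c : Fin k → Fin n) (i : Fin k) (α : Fin n) : ℂ :=
  if α < c i then a α
  else if α = c i then z * q₁ ^ (2 * (i : ℤ) + 1 - k) * (∏ α ∈ Iic (c i), K α) * a (c i)
  else K α * a α

lemma stabTerm_eq (q₁ q₂ z : ℂ) (a K : Fin n → ℂ) (c : Fin k → Fin n) (x : Fin k → ℂ) :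
    stabTerm q₁ q₂ z a K c x =
      (∏ i, ∏ j ∈ Ioi i, theta q₂⁻¹ (q₁ * x j / x i) / theta q₂⁻¹ (x j / x i)) *
      ∏ i, ∏ α, theta q₂⁻¹ (stabWeight q₁ z a K c i α / x i) / theta q₂⁻¹ (K α * a α / x i) := by
  unfold stabTerm
  congr 1
  refine prod_congr rfl fun i _ => ?_
  rw [prod_div_distrib, ← prod_Iio_mul_Ioi]
  congr 1
  refine prod_congr rfl fun α _ => ?_
  unfold stabWeight
  split_ifs <;> rfl

lemma prod_stabWeight_div {q₁ z : ℂ} {a K : Fin n → ℂ} (ha : ∀ α, a α ≠ 0) (hK : ∀ α, K α ≠ 0)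
    (c : Fin k → Fin n) (i : Fin k) :
    ∏ α, stabWeight q₁ z a K c i α / (K α * a α) = z * q₁ ^ (2 * (i : ℤ) + 1 - k) := by
  have h1 : ∀ α, stabWeight q₁ z a K c i α / (K α * a α) =
      if α < c i then (K α)⁻¹
      else if α = c i then z * q₁ ^ (2 * (i : ℤ) + 1 - k) * ∏ β ∈ Iio (c i), K β else 1 := by
    intro α
    have h2 := ha α
    have h3 := hK α
    unfold stabWeight
    split_ifs with h h'
    · field_simp
    · subst h'
      rw [prod_Iic_eq]
      field_simp
    · field_simp
  have h0 : ∏ β ∈ Iio (c i), K β ≠ 0 := prod_ne_zero_iff.2 fun β _ => hK β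
  rw [prod_congr rfl fun α _ => h1 α, prod_Iio_mul_Ioi, prod_const_one, prod_inv_distrib]
  field_simp

lemma prod_zpow_sub {q : ℂ} (hq : q ≠ 0) (N : Fin k → ℤ) :
    ∏ i, ∏ j ∈ Ioi i, q ^ (N i - N j) = ∏ i : Fin k, (q ^ ((k : ℤ) - 1 - 2 * (i : ℤ))) ^ N i := by
  have h1 : ∏ i, ∏ j ∈ Ioi i, q ^ (N j) = ∏ j, ∏ _i ∈ Iio j, q ^ (N j) :=
    prod_comm' (by simp)
  simp only [fun i j => zpow_sub₀ hq (N i) (N j), prod_div_distrib]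
  rw [h1, ← prod_div_distrib]
  refine prod_congr rfl fun i _ => ?_
  have hi := i.2
  rw [prod_const, prod_const, Fin.card_Ioi, Fin.card_Iio, ← zpow_natCast, ← zpow_natCast,
    ← zpow_mul, ← zpow_mul, ← zpow_mul, ← zpow_sub₀ hq]
  congr 1
  have : ((k - 1 - i : ℕ) : ℤ) = k - 1 - i := by omega
  rw [this]
  ring

lemma stabTerm_zpow_mul {q₁ q₂ z : ℂ} {a K : Fin n → ℂ} (hq₁ : q₁ ≠ 0) (hp0 : q₂⁻¹ ≠ 0)
    (hp : ‖q₂⁻¹‖ < 1) (hz : z ≠ 0) (ha : ∀ α, a α ≠ 0) (hK : ∀ α, K α ≠ 0) (c : Fin k → Fin n)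
    {x : Fin k → ℂ} (hx : ∀ i, x i ≠ 0) (N : Fin k → ℤ) :
    stabTerm q₁ q₂ z a K c (fun i => q₂ ^ (-N i) * x i) =
      z ^ (∑ i, N i) * stabTerm q₁ q₂ z a K c x := by
  have hq₂ : q₂ ≠ 0 := fun h => hp0 (by simp [h])
  have hKa : ∀ α, K α * a α ≠ 0 := fun α => mul_ne_zero (hK α) (ha α)
  have hw : ∀ i α, stabWeight q₁ z a K c i α ≠ 0 := by
    intro i α
    unfold stabWeight
    split_ifs
    · exact ha α
    · exact mul_ne_zero (mul_ne_zero (mul_ne_zero hz (zpow_ne_zero _ hq₁))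
        (prod_ne_zero_iff.2 fun α _ => hK α)) (ha _)
    · exact hKa α
  have hpair : ∀ i j, theta q₂⁻¹ (q₁ * (q₂ ^ (-N j) * x j) / (q₂ ^ (-N i) * x i)) /
      theta q₂⁻¹ (q₂ ^ (-N j) * x j / (q₂ ^ (-N i) * x i)) =
      q₁ ^ (N i - N j) * (theta q₂⁻¹ (q₁ * x j / x i) / theta q₂⁻¹ (x j / x i)) := by
    intro i j
    have hxi := hx i
    have hxj := hx j
    have e : q₂ ^ (-N j) * x j / (q₂ ^ (-N i) * x i) = q₂⁻¹ ^ (N j - N i) * (x j / x i) := by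
      rw [inv_zpow', neg_sub, zpow_sub₀ hq₂, zpow_neg, zpow_neg]
      have := zpow_ne_zero (N i) hq₂
      have := zpow_ne_zero (N j) hq₂
      field_simp
    rw [mul_div_assoc, e, mul_left_comm, mul_div_assoc,
      theta_zpow_mul_div hp0 hp (mul_ne_zero hq₁ (div_ne_zero hxj hxi)) (div_ne_zero hxj hxi)]
    congr 1
    rw [← neg_sub (N j), zpow_neg, ← inv_zpow]
    congr 1
    field_simp
  have hsingle : ∀ i α, theta q₂⁻¹ (stabWeight q₁ z a K c i α / (q₂ ^ (-N i) * x i)) /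
      theta q₂⁻¹ (K α * a α / (q₂ ^ (-N i) * x i)) =
      (stabWeight q₁ z a K c i α / (K α * a α)) ^ N i *
        (theta q₂⁻¹ (stabWeight q₁ z a K c i α / x i) / theta q₂⁻¹ (K α * a α / x i)) := by
    intro i α
    have hxi := hx i
    have e : ∀ v : ℂ, v / (q₂ ^ (-N i) * x i) = q₂⁻¹ ^ (-N i) * (v / x i) := by
      intro v
      rw [inv_zpow', neg_neg, zpow_neg]
      have := zpow_ne_zero (N i) hq₂
      field_simp
    rw [e, e, theta_zpow_mul_div hp0 hp (div_ne_zero (hw i α) hxi) (div_ne_zero (hKa α) hxi),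
      zpow_neg, ← inv_zpow]
    congr 2
    rw [inv_div, div_div_div_cancel_right₀ hxi]
  rw [stabTerm_eq, stabTerm_eq]
  simp only [hpair, hsingle, prod_mul_distrib, prod_zpow, prod_stabWeight_div ha hK]
  have hfac : (∏ i, ∏ j ∈ Ioi i, q₁ ^ (N i - N j)) *
      ∏ i : Fin k, (z * q₁ ^ (2 * (i : ℤ) + 1 - k)) ^ N i = z ^ (∑ i, N i) := by
    rw [prod_zpow_sub hq₁, ← prod_mul_distrib]
    have hsum : ∀ s : Finset (Fin k), z ^ (∑ i ∈ s, N i) = ∏ i ∈ s, z ^ N i := by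
      intro s
      induction s using Finset.induction_on with
      | empty => simp
      | insert i s hi ih => rw [sum_insert hi, prod_insert hi, zpow_add₀ hz, ih]
    rw [hsum]
    refine prod_congr rfl fun i _ => ?_
    rw [← mul_zpow, mul_left_comm, ← zpow_add₀ hq₁]
    ring_nf
    simp
  rw [← hfac]
  ring

/-- Quasi-periodicity of the stable envelope; it holds for each term of the symmetrisation. -/
theorem offShellStab_zpow_mul {q₁ q₂ z : ℂ} {a K : Fin n → ℂ} (hq₁ : q₁ ≠ 0) (hp0 : q₂⁻¹ ≠ 0)
    (hp : ‖q₂⁻¹‖ < 1) (hz : z ≠ 0) (ha : ∀ α, a α ≠ 0) (hK : ∀ α, K α ≠ 0) (c : Fin k → Fin n)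
    {x : Fin k → ℂ} (hx : ∀ i, x i ≠ 0) (N : Fin k → ℤ) :
    offShellStab q₁ q₂ z a K c (fun i => q₂ ^ (-N i) * x i) =
      z ^ (∑ i, N i) * offShellStab q₁ q₂ z a K c x := by
  unfold offShellStab
  rw [mul_sum]
  refine sum_congr rfl fun w _ => ?_
  rw [← Equiv.sum_comp w N]
  exact stabTerm_zpow_mul hq₁ hp0 hp hz ha hK c (fun i => hx (w i)) (fun i => N (w i))

lemma perm_eq_one_of_le {σ : Equiv.Perm (Fin k)} (h : ∀ I, I ≤ σ I) : σ = 1 := by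
  have hsum : ∑ I : Fin k, (I : ℕ) = ∑ I, (σ I : ℕ) := (Equiv.sum_comp σ _).symm
  have := (sum_eq_sum_iff_of_le fun I _ => (Fin.le_def.1 (h I))).1 hsum
  ext I
  simpa using (this I (mem_univ I)).symm

namespace Generic
variable {q₁ q₂ : ℂ} {a K : Fin n → ℂ} {c' : Fin k → Fin n} (G : Generic q₁ q₂ a K c')
include G

/-- The stable envelope at the pole labelled by `ν` differs from its value at the base point by
the quasi-periodicity factor. -/
lemma offShellStab_pole {z : ℂ} (hz : z ≠ 0) (c : Fin k → Fin n) (ν : Fin k → ℕ) :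
    blockConst q₁ q₂ z K c * offShellStab q₁ q₂ z a K c (pole q₁ q₂ a c' ν) =
      z ^ (∑ I, ν I) * onShellStab q₁ q₂ z a K c c' := by
  have h1 : pole q₁ q₂ a c' ν = fun i => q₂ ^ (-(ν i : ℤ)) * pole q₁ q₂ a c' 0 i := by
    ext i
    simp [pole, mul_comm]
  rw [h1, offShellStab_zpow_mul G.q₁_ne G.p_ne G.norm_p hz G.a_ne G.K_ne c (G.pole_ne 0)
    (fun i => (ν i : ℤ)), ← Nat.cast_sum, zpow_natCast, onShellStab]
  ring

/-- At the base point only the identity permutation contributes to the symmetrisation: in all other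
terms a theta function vanishes, either between neighbouring boxes of one colour or between a first
box and its framing parameter. -/
lemma stabTerm_eq_zero (z : ℂ) {w : Equiv.Perm (Fin k)} (hw : w ≠ 1) :
    stabTerm q₁ q₂ z a K c' (pole q₁ q₂ a c' 0 ∘ w) = 0 := by
  by_contra hne
  rw [stabTerm_eq] at hne
  have hA := prod_ne_zero_iff.1 (left_ne_zero_of_mul hne)
  have hB := prod_ne_zero_iff.1 (right_ne_zero_of_mul hne)
  have happ : ∀ I, w (w⁻¹ I) = I := fun I => w.apply_symm_apply I
  -- if the term does not vanish, then `I ≤ w⁻¹ I` for all `I`, by induction on the position of `I`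
  refine hw (inv_eq_one.1 (perm_eq_one_of_le (σ := w⁻¹) fun I => ?_))
  obtain ⟨m, hm⟩ : ∃ m, pos c' I = m := ⟨_, rfl⟩
  induction m generalizing I with
  | zero =>
    by_contra hlt
    rw [not_le] at hlt
    have hcol : c' I < c' (w⁻¹ I) := by
      refine lt_of_le_of_ne (G.anti hlt.le) fun h => ?_
      have := pos_lt_pos hlt h.symm
      omega
    refine prod_ne_zero_iff.1 (hB (w⁻¹ I) (mem_univ _)) (c' I) (mem_univ _) ?_
    have e : stabWeight q₁ z a K c' (w⁻¹ I) (c' I) / (pole q₁ q₂ a c' 0 ∘ w) (w⁻¹ I) = 1 := by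
      rw [stabWeight, if_pos hcol, Function.comp_apply, happ, pole, hm]
      simp [div_self (G.a_ne _)]
    rw [e, theta_one, zero_div]
  | succ m ih =>
    obtain ⟨hI0, hcol, hpos⟩ := pos_prevIdx G.anti (I := I) (by omega)
    have hprev := ih (prevIdx I) (by omega)
    suffices h : w⁻¹ (prevIdx I) < w⁻¹ I by
      simp only [prevIdx, Fin.le_def, Fin.lt_def] at hprev h ⊢
      omega
    by_contra hlt
    have hne' : w⁻¹ I ≠ w⁻¹ (prevIdx I) := by
      refine (w⁻¹).injective.ne fun h => ?_
      rw [← h] at hpos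
      omega
    have hlt' : w⁻¹ I < w⁻¹ (prevIdx I) := lt_of_le_of_ne (not_lt.1 hlt) hne'
    refine prod_ne_zero_iff.1 (hA (w⁻¹ I) (mem_univ _)) _ (mem_Ioi.2 hlt') ?_
    have e := G.mul_pole_div_pole 0 I (prevIdx I) 1
    rw [hcol, hpos, div_self (G.a_ne _), zpow_one, ← mul_div_assoc] at e
    simp only [Function.comp_apply, happ]
    rw [e]
    simp [theta_one]

theorem onShellStab_eq_onShellProd (z : ℂ) :
    onShellStab q₁ q₂ z a K c' c' = onShellProd q₁ q₂ z a K c' := by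
  have hsum : offShellStab q₁ q₂ z a K c' (pole q₁ q₂ a c' 0) =
      stabTerm q₁ q₂ z a K c' (pole q₁ q₂ a c' 0) := by
    unfold offShellStab
    rw [sum_eq_single 1 (fun w _ hw => G.stabTerm_eq_zero z hw) (by simp)]
    rfl
  rw [onShellStab, hsum, stabTerm_eq, blockConst, onShellProd, mul_left_comm, ← prod_mul_distrib]
  have hdiv : ∀ I β, a β / pole q₁ q₂ a c' 0 I =
      q₁ ^ (-(pos c' I : ℤ)) * (a β / a (c' I)) := by
    intro I β
    rw [G.div_pole]
    simp
  congr 1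
  · refine prod_congr rfl fun I _ => prod_congr rfl fun J _ => ?_
    have e0 := G.mul_pole_div_pole 0 I J 0
    have e1 := G.mul_pole_div_pole 0 I J 1
    simp only [zpow_zero, one_mul, add_zero, Pi.zero_apply, Nat.cast_zero, sub_zero, mul_one,
      zpow_one] at e0 e1
    rw [mul_div_assoc, e1, e0]
  · refine prod_congr rfl fun I _ => ?_
    have hterm : ∀ β, theta q₂⁻¹ (stabWeight q₁ z a K c' I β / pole q₁ q₂ a c' 0 I) /
        theta q₂⁻¹ (K β * a β / pole q₁ q₂ a c' 0 I) =
        if β < c' I then theta q₂⁻¹ (q₁ ^ (-(pos c' I : ℤ)) * (a β / a (c' I))) /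
          theta q₂⁻¹ (q₁ ^ (-(pos c' I : ℤ)) * K β * (a β / a (c' I)))
        else if β = c' I then
          theta q₂⁻¹ (q₁ ^ (-(pos c' I : ℤ) + (2 * (I : ℤ) + 1 - k)) * z *
            ∏ α ∈ Iic (c' I), K α) / theta q₂⁻¹ (q₁ ^ (-(pos c' I : ℤ)) * K (c' I))
        else 1 := by
      intro β
      have hKβ : K β * a β / pole q₁ q₂ a c' 0 I =
          q₁ ^ (-(pos c' I : ℤ)) * K β * (a β / a (c' I)) := by
        rw [mul_div_assoc, hdiv]; ring
      unfold stabWeight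
      split_ifs with h h'
      · rw [hKβ, hdiv]
      · subst h'
        rw [hKβ, div_self (G.a_ne _), mul_one, mul_div_assoc, hdiv, div_self (G.a_ne _),
          zpow_add₀ G.q₁_ne]
        ring_nf
      · refine div_self (theta_ne_zero G.p_ne G.norm_p ?_ (G.K_div_pole_ne 0 I β))
        exact div_ne_zero (mul_ne_zero (G.K_ne β) (G.a_ne β)) (G.pole_ne 0 I)
    rw [prod_congr rfl fun β _ => hterm β, prod_Iio_mul_Ioi, prod_const_one, mul_one,
      mul_left_comm, div_mul_div_comm]
    congr 1
    rw [mul_comm (theta q₂⁻¹ (K (c' I))), mul_comm z, mul_comm (theta q₂⁻¹ (_ * _ * _))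
      (theta q₂⁻¹ (q₁ ^ (-(pos c' I : ℤ)) * K (c' I)))]

end Generic

/-! ### Convergence of the vortex sum -/

section
variable {p : ℂ}

lemma tendsto_prod_range (hp : ‖p‖ < 1) (x : ℂ) :
    Filter.Tendsto (fun m => ∏ l ∈ range m, (1 - x * p ^ l)) Filter.atTop
      (nhds (qPochInf p x)) := by
  have := multipliable_qRed hp 0 x
  simp only [zero_mul, zero_ne_one, if_false] at this
  exact this.hasProd.tendsto_prod_nat

lemma exists_norm_prod_div_le (hp : ‖p‖ < 1) (x : ℂ) {y : ℂ} (hy : ∀ m : ℕ, y * p ^ m ≠ 1) :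
    ∃ C : ℝ, ∀ m : ℕ,
      ‖(∏ l ∈ range m, (1 - x * p ^ l)) / ∏ l ∈ range m, (1 - y * p ^ l)‖ ≤ C := by
  have h := (tendsto_prod_range hp x).div (tendsto_prod_range hp y) (qPochInf_ne_zero hp hy)
  obtain ⟨C, hC⟩ := (Metric.isBounded_range_of_tendsto _ h).exists_norm_le
  exact ⟨C, fun m => hC _ ⟨m, rfl⟩⟩

lemma exists_norm_qPoch_natCast_div_le (hp : ‖p‖ < 1) (u : ℂ) {v : ℂ}
    (hv : ∀ m : ℕ, v * p ^ m ≠ 1) :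
    ∃ C : ℝ, ∀ m : ℕ, ‖qPoch p u m / qPoch p v m‖ ≤ C := by
  simp only [qPoch_natCast]
  exact exists_norm_prod_div_le hp u hv

lemma exists_norm_qPoch_neg_div_le (hp0 : p ≠ 0) (hp : ‖p‖ < 1) {u v : ℂ} (hu : u ≠ 0)
    (hv : v ≠ 0) (h : ∀ l : ℤ, l < 0 → u * p ^ l ≠ 1) :
    ∃ C : ℝ, ∀ m : ℕ, ‖qPoch p u (-(m : ℤ)) / qPoch p v (-(m : ℤ))‖ ≤ C * ‖v / u‖ ^ m := by
  obtain ⟨C, hC⟩ := exists_norm_prod_div_le hp (p / v) (y := p / u) fun m hm => by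
    refine h (-((m : ℤ) + 1)) (by omega) ?_
    rw [zpow_neg, zpow_add_one₀ hp0, zpow_natCast]
    field_simp at hm ⊢
    exact hm.symm
  refine ⟨C, fun m => ?_⟩
  -- `1 - v p^(-l)` is `-v p^(-l)` times `1 - p^l / v`
  have hflip : ∀ {w : ℂ}, w ≠ 0 → ∏ l ∈ range m, (1 - w * p ^ (-((l : ℤ) + 1))) =
      (∏ l ∈ range m, (-(p ^ (-((l : ℤ) + 1))))) * w ^ m *
        ∏ l ∈ range m, (1 - p / w * p ^ l) := by
    intro w hw
    rw [← card_range m, ← prod_const, card_range, ← prod_mul_distrib, ← prod_mul_distrib]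
    refine prod_congr rfl fun l _ => ?_
    rw [zpow_neg, zpow_add_one₀ hp0, zpow_natCast]
    field_simp
    ring
  have hP : ∏ l ∈ range m, (-(p ^ (-((l : ℤ) + 1)))) ≠ 0 :=
    prod_ne_zero_iff.2 fun l _ => neg_ne_zero.2 (zpow_ne_zero _ hp0)
  have e : qPoch p u (-(m : ℤ)) / qPoch p v (-(m : ℤ)) =
      (v / u) ^ m * ((∏ l ∈ range m, (1 - p / v * p ^ l)) / ∏ l ∈ range m, (1 - p / u * p ^ l)) := by
    rw [qPoch_neg_natCast, qPoch_neg_natCast, inv_div_inv, hflip hu, hflip hv, mul_div_mul_comm,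
      mul_div_mul_left _ _ hP, div_pow]
  rw [e, norm_mul, norm_pow, mul_comm]
  exact mul_le_mul_of_nonneg_right (hC m) (by positivity)

end

lemma summable_prod_pow {r : ℝ} (h0 : 0 ≤ r) (h1 : r < 1) (k : ℕ) :
    Summable fun ν : Fin k → ℕ => ∏ I, r ^ ν I := by
  induction k with
  | zero => exact Summable.of_finite
  | succ k ih =>
    rw [← (Fin.consEquiv fun _ : Fin (k + 1) => ℕ).summable_iff]
    have := (summable_geometric_of_lt_one h0 h1).mul_of_nonneg ih (fun m => by positivity)
      (fun ν => by positivity)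
    refine this.congr fun x => ?_
    simp [Fin.prod_univ_succ, Fin.consEquiv]

namespace Generic
variable {q₁ q₂ : ℂ} {a K : Fin n → ℂ} {c' : Fin k → Fin n} (G : Generic q₁ q₂ a K c')
include G

/-- The interaction of two boxes is bounded; the bound for `d < 0` uses `|q₁| > 1`. -/
lemma exists_norm_pair_le {I J : Fin k} (hIJ : I ≠ J) : ∃ C : ℝ, ∀ d : ℤ,
    ‖qPoch q₂⁻¹ (q₁ ^ ((pos c' J : ℤ) - pos c' I + 1) * (a (c' J) / a (c' I))) d /
      qPoch q₂⁻¹ (q₁ ^ ((pos c' J : ℤ) - pos c' I) * (a (c' J) / a (c' I))) d‖ ≤ C := by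
  have hw : ∀ s : ℤ, q₁ ^ s * (a (c' J) / a (c' I)) ≠ 0 := fun s =>
    mul_ne_zero (zpow_ne_zero _ G.q₁_ne) (div_ne_zero (G.a_ne _) (G.a_ne _))
  obtain ⟨C₁, hC₁⟩ := exists_norm_qPoch_natCast_div_le G.norm_p
    (q₁ ^ ((pos c' J : ℤ) - pos c' I + 1) * (a (c' J) / a (c' I)))
    (v := q₁ ^ ((pos c' J : ℤ) - pos c' I) * (a (c' J) / a (c' I)))
    (fun m => by simpa using G.pair_ne_one hIJ m)
  obtain ⟨C₂, hC₂⟩ := exists_norm_qPoch_neg_div_le G.p_ne G.norm_p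
    (hw ((pos c' J : ℤ) - pos c' I + 1)) (hw ((pos c' J : ℤ) - pos c' I)) (fun l hl h => by
      obtain ⟨hcol, hs⟩ := G.eq_of_zpow_eq (abs_pos_sub_le c' I J) h
      rw [hcol, hs, div_self (G.a_ne _), zpow_zero, one_mul, one_mul] at h
      have := G.zpow_eq_one h
      omega)
  have hC₂0 : 0 ≤ C₂ := by simpa using (norm_nonneg _).trans (hC₂ 0)
  refine ⟨max C₁ C₂, fun d => ?_⟩
  obtain ⟨m, rfl | rfl⟩ := d.eq_nat_or_neg
  · exact (hC₁ m).trans (le_max_left _ _)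
  · refine (hC₂ m).trans ((mul_le_of_le_one_right hC₂0 (pow_le_one₀ (norm_nonneg _) ?_)).trans
      (le_max_right _ _))
    rw [zpow_add_one₀ G.q₁_ne, mul_right_comm, div_mul_cancel_left₀ (hw _), norm_inv]
    exact inv_le_one_of_one_le₀ G.norm_q₁.le

lemma exists_norm_frame_le (I : Fin k) (β : Fin n) : ∃ C : ℝ, ∀ m : ℕ,
    ‖qPoch q₂⁻¹ (q₁ ^ (-(pos c' I : ℤ)) * (a β / a (c' I))) (-(m : ℤ)) /
      qPoch q₂⁻¹ (q₁ ^ (-(pos c' I : ℤ)) * K β * (a β / a (c' I))) (-(m : ℤ))‖ ≤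
        C * ‖K β‖ ^ m := by
  have hw : q₁ ^ (-(pos c' I : ℤ)) * (a β / a (c' I)) ≠ 0 :=
    mul_ne_zero (zpow_ne_zero _ G.q₁_ne) (div_ne_zero (G.a_ne _) (G.a_ne _))
  have e : q₁ ^ (-(pos c' I : ℤ)) * K β * (a β / a (c' I)) =
      K β * (q₁ ^ (-(pos c' I : ℤ)) * (a β / a (c' I))) := by ring
  obtain ⟨C, hC⟩ := exists_norm_qPoch_neg_div_le G.p_ne G.norm_p hw
    (mul_ne_zero (G.K_ne β) hw) (fun l hl h => by
      obtain ⟨hcol, hs⟩ := G.eq_of_zpow_eq (by have := pos_lt (c' := c') I; rw [abs_le]; omega) h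
      rw [hcol, hs, div_self (G.a_ne _), zpow_zero, one_mul, one_mul] at h
      have := G.zpow_eq_one h
      omega)
  rw [mul_div_cancel_right₀ _ hw] at hC
  rw [e]
  exact ⟨C, hC⟩

lemma exists_norm_vortexPart_le : ∃ C : ℝ, ∀ ν : Fin k → ℕ,
    ‖vortexPart q₁ q₂ a K c' ν‖ ≤ C * ∏ I, ‖∏ β, K β‖ ^ ν I := by
  have hpair : ∀ I J : Fin k, ∃ C : ℝ, I ≠ J → ∀ d : ℤ,
      ‖qPoch q₂⁻¹ (q₁ ^ ((pos c' J : ℤ) - pos c' I + 1) * (a (c' J) / a (c' I))) d /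
        qPoch q₂⁻¹ (q₁ ^ ((pos c' J : ℤ) - pos c' I) * (a (c' J) / a (c' I))) d‖ ≤ C := by
    intro I J
    by_cases hIJ : I = J
    · exact ⟨0, fun h => absurd hIJ h⟩
    · obtain ⟨C, hC⟩ := G.exists_norm_pair_le hIJ
      exact ⟨C, fun _ => hC⟩
  choose A hA using hpair
  choose B hB using G.exists_norm_frame_le
  refine ⟨(∏ I, ∏ J ∈ univ.erase I, A I J) * ∏ I, ∏ β, B I β, fun ν => ?_⟩
  unfold vortexPart
  rw [norm_mul, mul_assoc, ← prod_mul_distrib]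
  refine mul_le_mul ?_ ?_ (norm_nonneg _) ?_
  · rw [norm_prod]
    refine prod_le_prod (fun I _ => norm_nonneg _) fun I _ => ?_
    rw [norm_prod]
    exact prod_le_prod (fun J _ => norm_nonneg _) fun J hJ =>
      hA I J (ne_of_mem_erase hJ).symm _
  · rw [norm_prod]
    refine prod_le_prod (fun I _ => norm_nonneg _) fun I _ => ?_
    rw [norm_prod, norm_prod, ← prod_pow, ← prod_mul_distrib]
    exact prod_le_prod (fun β _ => norm_nonneg _) fun β _ => hB I β (ν I)
  · exact prod_nonneg fun I _ => prod_nonneg fun J hJ =>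
      (norm_nonneg _).trans (hA I J (ne_of_mem_erase hJ).symm 0)

theorem summable_vortexTerm {z : ℂ} (hz : ‖z * ∏ α, K α‖ < 1) :
    Summable (vortexTerm q₁ q₂ z a K c') := by
  obtain ⟨C, hC⟩ := G.exists_norm_vortexPart_le
  have h1 := ((summable_prod_pow (norm_nonneg _) hz k).mul_left C).comp_injective
    (i := fun ν : InvPart c' => ν.1) Subtype.val_injective
  refine Summable.of_norm_bounded h1 fun ν => ?_
  rw [vortexTerm, norm_mul, norm_pow, ← prod_pow_eq_pow_sum]
  refine (mul_le_mul_of_nonneg_left (hC ν.1) (by positivity)).trans (le_of_eq ?_)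
  simp only [Function.comp_apply, norm_mul, mul_pow, prod_mul_distrib]
  ring

end Generic

/-! ### The vertex function of the cotangent bundle of the Grassmannian -/

lemma eulerLine_eq (q x : ℂ) (d : ℤ) : eulerLine q x d = qPoch q⁻¹ (1 / x) (-d) := by
  rw [eulerLine, qPoch, neg_neg, mul_comm]
  congr 1
  · refine prod_congr rfl fun m _ => ?_
    rw [mul_inv, inv_pow, one_div]
  · congr 1
    refine prod_congr rfl fun m _ => ?_
    rw [mul_inv, one_div, inv_zpow]

lemma qPoch_mul_polarRoot {q s x κ : ℂ} (hq : q ≠ 0) (hs : s ≠ 0) (hx : x ≠ 0)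
    (hκ : s ^ 2 = κ * q) (d : ℤ) :
    qPoch q⁻¹ (x / s ^ 2) d * polarRoot q s x d =
      (qPoch q⁻¹ (κ / x) (-d))⁻¹ * (-q / s) ^ d := by
  have hqs : -q / s ≠ 0 := div_ne_zero (neg_ne_zero.2 hq) hs
  have hκ' : κ = s ^ 2 / q := by rw [hκ]; field_simp
  have hqi := fun j : ℤ => zpow_ne_zero j hq
  obtain ⟨m, rfl | rfl⟩ := d.eq_nat_or_neg
  · rw [qPoch_natCast, qPoch_neg_natCast, inv_inv]
    induction m with
    | zero => simp [polarRoot]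
    | succ m ih =>
      have hroot : polarRoot q s x ((m + 1 : ℕ) : ℤ) =
          polarRoot q s x m * (s * x⁻¹ * (q ^ m * q)) := by
        unfold polarRoot
        rw [Nat.cast_succ, tri_succ, zpow_add_one₀ hs, neg_add, zpow_add₀ hx, zpow_add₀ hq,
          zpow_add_one₀ hq, zpow_neg_one, zpow_natCast q m]
        ring
      have hqm := hqi m
      rw [zpow_natCast] at hqm
      have hstep : (1 - x / s ^ 2 * q⁻¹ ^ m) * (s * x⁻¹ * (q ^ m * q)) =
          (1 - κ / x * q⁻¹ ^ (-((m : ℤ) + 1))) * (-q / s) := by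
        rw [inv_zpow', neg_neg, zpow_add_one₀ hq, zpow_natCast, hκ', inv_pow]
        field_simp
        ring
      rw [prod_range_succ, prod_range_succ, hroot, mul_mul_mul_comm, ih, hstep, Nat.cast_succ,
        zpow_add_one₀ hqs]
      ring
  · rw [neg_neg, qPoch_natCast, qPoch_neg_natCast]
    induction m with
    | zero => simp [polarRoot]
    | succ m ih =>
      have htri : (-((m : ℤ) + 1)) * (-((m : ℤ) + 1) + 1) / 2 =
          (-(m : ℤ)) * (-(m : ℤ) + 1) / 2 + m := by
        have h2 := tri_succ (-((m : ℤ) + 1))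
        have h3 : -((m : ℤ) + 1) + 1 = -m := by ring
        rw [h3] at h2 ⊢
        linarith
      have hroot : polarRoot q s x (-((m + 1 : ℕ) : ℤ)) =
          polarRoot q s x (-(m : ℤ)) * (s⁻¹ * x * q ^ m) := by
        unfold polarRoot
        rw [Nat.cast_succ, htri, neg_neg, neg_neg, zpow_add_one₀ hx, neg_add, zpow_add₀ hs,
          zpow_add₀ hq, zpow_neg_one, zpow_natCast q m]
        ring
      have hqm := hqi m
      rw [zpow_natCast] at hqm
      have hfac : 1 - x / s ^ 2 * q⁻¹ ^ (-((m : ℤ) + 1)) =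
          (1 - κ / x * q⁻¹ ^ m) * (s⁻¹ * x * q ^ m) * (-q / s) := by
        rw [inv_zpow', neg_neg, zpow_add_one₀ hq, zpow_natCast, hκ', inv_pow]
        field_simp
        ring
      have hu : s⁻¹ * x * q ^ m ≠ 0 := mul_ne_zero (mul_ne_zero (inv_ne_zero hs) hx) hqm
      -- both factors vanish together, so that this also holds with the convention `0⁻¹ = 0`
      have hstep : (1 - x / s ^ 2 * q⁻¹ ^ (-((m : ℤ) + 1)))⁻¹ * (s⁻¹ * x * q ^ m) =
          (1 - κ / x * q⁻¹ ^ m)⁻¹ * (-q / s)⁻¹ := by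
        rw [hfac, mul_inv, mul_inv, mul_right_comm, mul_assoc (1 - κ / x * q⁻¹ ^ m)⁻¹,
          inv_mul_cancel₀ hu, mul_one]
      have hpow : (-q / s) ^ (-((m + 1 : ℕ) : ℤ)) = (-q / s) ^ (-(m : ℤ)) * (-q / s)⁻¹ := by
        rw [Nat.cast_succ, neg_add, zpow_add₀ hqs, zpow_neg_one]
      rw [prod_range_succ, prod_range_succ, hroot, mul_inv, mul_mul_mul_comm, ih, hstep, hpow,
        mul_inv]
      ring

lemma polarFactor_eq {q s x κ : ℂ} (hq : q ≠ 0) (hs : s ≠ 0) (hx : x ≠ 0) (hκ : s ^ 2 = κ * q)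
    (d : ℤ) : polarFactor q s x d =
      qPoch q⁻¹ (1 / x) (-d) / qPoch q⁻¹ (κ / x) (-d) * (-q / s) ^ d := by
  rw [polarFactor, eulerLine_eq, eulerLine_eq, neg_neg, one_div_div, mul_assoc,
    qPoch_mul_polarRoot hq hs hx hκ]
  ring

lemma qPoch_zero (p u : ℂ) : qPoch p u 0 = 1 := by simp [qPoch]

lemma pos_eq_zero {c' : Fin k → Fin n} (hinj : Function.Injective c') (I : Fin k) :
    pos c' I = 0 := by
  refine card_eq_zero.2 (filter_eq_empty_iff.2 fun J _ h => ?_)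
  exact h.1.ne (hinj h.2)

/-- For an injective colouring the boxes correspond to the elements of the fixed point. -/
def boxEquiv {c' : Fin k → Fin n} (hinj : Function.Injective c') :
    Fin k ≃ {α // α ∈ univ.image c'} :=
  Equiv.ofBijective (fun I => ⟨c' I, mem_image_of_mem c' (mem_univ I)⟩)
    ⟨fun I J h => hinj (congrArg Subtype.val h), fun α => by
      obtain ⟨I, _, hI⟩ := mem_image.1 α.2
      exact ⟨I, Subtype.ext hI⟩⟩

lemma coe_boxEquiv {c' : Fin k → Fin n} (hinj : Function.Injective c') (I : Fin k) :
    (boxEquiv hinj I : Fin n) = c' I := rfl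

/-- For an injective colouring the tuples of inverse partitions are the degrees of the fixed
quasimaps. -/
def invPartEquiv {c' : Fin k → Fin n} (hinj : Function.Injective c') :
    InvPart c' ≃ ({α // α ∈ univ.image c'} → ℕ) where
  toFun ν α := ν.1 ((boxEquiv hinj).symm α)
  invFun d := ⟨fun I => d (boxEquiv hinj I), fun I J _ h => by rw [hinj h]⟩
  left_inv ν := Subtype.ext (by ext I; simp)
  right_inv d := by ext α; simp

lemma vertexTerm_eq_vortexTerm {q₁ q₂ z κ s : ℂ} {a K : Fin n → ℂ} {c' : Fin k → Fin n}
    (hq₂ : q₂ ≠ 0) (ha : ∀ α, a α ≠ 0) (hK0 : ∀ α, K α ≠ 0) (hK : ∀ α, K α = κ)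
    (hκ : k ≤ 1 ∨ κ = q₁) (hs : s ^ 2 = κ * q₂) (hinj : Function.Injective c') (ν : InvPart c') :
    vertexTerm q₂ s (z * (-s / q₂) ^ n) a (univ.image c') (invPartEquiv hinj ν) =
      vortexTerm q₁ q₂ z a K c' ν := by
  rcases isEmpty_or_nonempty (Fin k) with hk | ⟨⟨I₀⟩⟩
  · have : IsEmpty {α // α ∈ univ.image c'} := (boxEquiv hinj).symm.isEmpty
    simp [vertexTerm, vortexTerm, vortexPart]
  have hκ0 : κ ≠ 0 := hK (c' I₀) ▸ hK0 _
  have hs0 : s ≠ 0 := by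
    rintro rfl
    exact mul_ne_zero hκ0 hq₂ (by rw [← hs]; ring)
  have hqs : -q₂ / s ≠ 0 := div_ne_zero (neg_ne_zero.2 hq₂) hs0
  have hν : ∀ I, invPartEquiv hinj ν (boxEquiv hinj I) = ν.1 I := fun I =>
    congrArg ν.1 ((boxEquiv hinj).symm_apply_apply I)
  have hpf : ∀ (α β : Fin n) (d : ℤ), polarFactor q₂ s (a α / a β) d =
      qPoch q₂⁻¹ (a β / a α) (-d) / qPoch q₂⁻¹ (κ * (a β / a α)) (-d) * (-q₂ / s) ^ d := by
    intro α β d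
    rw [polarFactor_eq hq₂ hs0 (div_ne_zero (ha α) (ha β)) hs, one_div_div, ← mul_div_assoc,
      div_div_eq_mul_div]
  -- the powers of `-q₂ / s` cancel between pairs of boxes
  have hpow : ∏ I, ∏ J, (-q₂ / s) ^ ((ν.1 I : ℤ) - ν.1 J) = 1 := by
    simp only [zpow_sub₀ hqs, prod_div_distrib]
    rw [prod_comm (f := fun _ J => (-q₂ / s) ^ (ν.1 J : ℤ)), div_self]
    exact prod_ne_zero_iff.2 fun I _ => prod_ne_zero_iff.2 fun J _ => zpow_ne_zero _ hqs
  have hsum : ∑ α, invPartEquiv hinj ν α = ∑ I, ν.1 I := by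
    rw [← Equiv.sum_comp (boxEquiv hinj)]
    exact sum_congr rfl fun I _ => hν I
  have hframe : ∏ α : {α // α ∈ univ.image c'}, ∏ β,
      polarFactor q₂ s (a α / a β) (invPartEquiv hinj ν α) =
      (∏ I, ∏ β, qPoch q₂⁻¹ (q₁ ^ (-(pos c' I : ℤ)) * (a β / a (c' I))) (-(ν.1 I : ℤ)) /
        qPoch q₂⁻¹ (q₁ ^ (-(pos c' I : ℤ)) * K β * (a β / a (c' I))) (-(ν.1 I : ℤ))) *
      ((-q₂ / s) ^ n) ^ ∑ I, ν.1 I := by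
    rw [← Equiv.prod_comp (boxEquiv hinj), ← prod_pow_eq_pow_sum, ← prod_mul_distrib]
    refine prod_congr rfl fun I _ => ?_
    have hconst : ((-q₂ / s) ^ n) ^ ν.1 I = ∏ _β : Fin n, (-q₂ / s) ^ ν.1 I := by
      rw [prod_const, card_fin, pow_right_comm]
    rw [hν, hconst, ← prod_mul_distrib]
    refine prod_congr rfl fun β _ => ?_
    rw [hpf, pos_eq_zero hinj, hK]
    simp [coe_boxEquiv]
  have hpair : ∏ α : {α // α ∈ univ.image c'}, ∏ β : {α // α ∈ univ.image c'},
      polarFactor q₂ s (a α / a β) ((invPartEquiv hinj ν α : ℤ) - invPartEquiv hinj ν β) =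
      (∏ I, ∏ J ∈ univ.erase I,
        qPoch q₂⁻¹ (q₁ ^ ((pos c' J : ℤ) - pos c' I + 1) * (a (c' J) / a (c' I)))
          ((ν.1 J : ℤ) - ν.1 I) /
        qPoch q₂⁻¹ (q₁ ^ ((pos c' J : ℤ) - pos c' I) * (a (c' J) / a (c' I)))
          ((ν.1 J : ℤ) - ν.1 I))⁻¹ := by
    rw [← mul_one (_⁻¹), ← hpow, ← prod_inv_distrib, ← prod_mul_distrib,
      ← Equiv.prod_comp (boxEquiv hinj)]
    refine prod_congr rfl fun I _ => ?_
    rw [← Equiv.prod_comp (boxEquiv hinj), ← mul_prod_erase univ _ (mem_univ I),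
      ← mul_prod_erase univ (fun J => (-q₂ / s) ^ ((ν.1 I : ℤ) - ν.1 J)) (mem_univ I),
      hpf, sub_self, sub_self, neg_zero, qPoch_zero, qPoch_zero, zpow_zero, div_one, one_mul,
      one_mul, one_mul, ← prod_inv_distrib, ← prod_mul_distrib]
    refine prod_congr rfl fun J hJ => ?_
    have hIJ := ne_of_mem_erase hJ
    have hκ' : κ = q₁ := by
      rcases hκ with h | h
      · exact absurd (Fin.ext (by omega)) hIJ
      · exact h
    rw [hpf, hν, hν, pos_eq_zero hinj, pos_eq_zero hinj, inv_div, neg_sub, hκ']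
    simp [coe_boxEquiv]
  have hζ : (z * (-s / q₂) ^ n) * (-q₂ / s) ^ n = z := by
    rw [mul_assoc, ← mul_pow, div_mul_div_comm, neg_mul_neg, mul_comm s q₂,
      div_self (mul_ne_zero hq₂ hs0), one_pow, mul_one]
  rw [vertexTerm, vortexTerm, vortexPart, hsum, hframe, hpair, div_inv_eq_mul]
  have hzN : z ^ (∑ I, ν.1 I) =
      (z * (-s / q₂) ^ n) ^ (∑ I, ν.1 I) * ((-q₂ / s) ^ n) ^ ∑ I, ν.1 I := by
    rw [← mul_pow, hζ]
  rw [hzN]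
  ring

/-- The vortex sum is the vertex function, term by term. -/
theorem vertexFunction_eq_tsum {q₁ q₂ z κ s : ℂ} {a K : Fin n → ℂ} {c' : Fin k → Fin n}
    (hq₂ : q₂ ≠ 0) (ha : ∀ α, a α ≠ 0) (hK0 : ∀ α, K α ≠ 0) (hK : ∀ α, K α = κ)
    (hκ : k ≤ 1 ∨ κ = q₁) (hs : s ^ 2 = κ * q₂) (hinj : Function.Injective c')
    (hsum : Summable (vortexTerm q₁ q₂ z a K c')) :
    Summable (vertexTerm q₂ s (z * (-s / q₂) ^ n) a (univ.image c')) ∧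
      ∑' ν, vortexTerm q₁ q₂ z a K c' ν =
        vertexFunction q₂ s (z * (-s / q₂) ^ n) a (univ.image c') := by
  have h : (vertexTerm q₂ s (z * (-s / q₂) ^ n) a (univ.image c')) ∘ invPartEquiv hinj =
      vortexTerm q₁ q₂ z a K c' :=
    funext fun ν => vertexTerm_eq_vortexTerm hq₂ ha hK0 hK hκ hs hinj ν
  constructor
  · rw [← (invPartEquiv hinj).summable_iff, h]
    exact hsum
  · rw [vertexFunction, ← (invPartEquiv hinj).tsum_eq, ← h]
    rfl

end A1Block

end

theorem mainTheorem4 {n k : ℕ} (q₁ q₂ z : ℂ) (a K : Fin n → ℂ) (c c' : Fin k → Fin n)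
    (hq₁ : 1 < ‖q₁‖) (hq₂ : 1 < ‖q₂‖) (hz : z ≠ 0) (ha : ∀ α, a α ≠ 0) (hK : ∀ α, K α ≠ 0)
    (hc : Antitone c) (hc' : Antitone c')
    -- genericity of the parameters
    (hgen_a : ∀ (α β : Fin n) (s m : ℤ), |s| ≤ k → a α = a β * q₁ ^ s * q₂ ^ m → α = β ∧ s = 0)
    (hgen_K : ∀ (β : Fin n) (I : Fin k) (m : ℤ),
      K β * a β ≠ a (c' I) * q₁ ^ pos c' I * q₂ ^ m)
    (hgen_z : ∀ (i : Fin k) (m : ℤ), dynParam q₁ z K c i ≠ q₂ ^ m) :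
    -- the residue at each pole
    (∀ ν : InvPart c', HasPoleContribution q₁ q₂ a c' (blockIntegrand q₁ q₂ z a K c) ν.1
      (onShellStab q₁ q₂ z a K c c' * pertPart q₁ q₂ a K c' * vortexTerm q₁ q₂ z a K c' ν)) ∧
    -- the total contribution of the poles
    (‖z * ∏ α, K α‖ < 1 →
      Summable (vortexTerm q₁ q₂ z a K c') ∧
      IsContribution q₁ q₂ a c' (blockIntegrand q₁ q₂ z a K c)
        (onShellStab q₁ q₂ z a K c c' * pertPart q₁ q₂ a K c' *
          ∑' ν, vortexTerm q₁ q₂ z a K c' ν)) ∧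
    -- the product formula for the on-shell stable envelope
    (c = c' → onShellStab q₁ q₂ z a K c c' = onShellProd q₁ q₂ z a K c') ∧
    -- the quasi-periodicity of the stable envelope, giving the factor `z^{|ν|}`
    ((∀ (x : Fin k → ℂ) (N : Fin k → ℤ), (∀ i, x i ≠ 0) →
      offShellStab q₁ q₂ z a K c (fun i => q₂ ^ (-N i) * x i) =
        z ^ (∑ i, N i) * offShellStab q₁ q₂ z a K c x) ∧
      ∀ ν : InvPart c', blockConst q₁ q₂ z K c * offShellStab q₁ q₂ z a K c (pole q₁ q₂ a c' ν.1) =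
        z ^ (∑ I, ν.1 I) * onShellStab q₁ q₂ z a K c c') ∧
    -- the agreement with the vertex function of the cotangent bundle of the Grassmannian
    (∀ κ s : ℂ, (∀ α, K α = κ) → (k ≤ 1 ∨ κ = q₁) → s ^ 2 = κ * q₂ → Function.Injective c' →
      ‖z * ∏ α, K α‖ < 1 →
      Summable (vertexTerm q₂ s (z * (-s / q₂) ^ n) a (Finset.univ.image c')) ∧
      ∑' ν, vortexTerm q₁ q₂ z a K c' ν =
        vertexFunction q₂ s (z * (-s / q₂) ^ n) a (Finset.univ.image c')) := by
  have G : Generic q₁ q₂ a K c' := ⟨hq₁, hq₂, ha, hK, hc', hgen_a, hgen_K⟩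
  have hres : ∀ ν : InvPart c', HasPoleContribution q₁ q₂ a c' (blockIntegrand q₁ q₂ z a K c) ν.1
      (onShellStab q₁ q₂ z a K c c' * pertPart q₁ q₂ a K c' * vortexTerm q₁ q₂ z a K c' ν) := by
    intro ν
    convert G.hasPoleContribution hz c ν using 1
    rw [G.offShellStab_pole hz, G.regPart_pole, vortexTerm]
    ring
  refine ⟨hres, fun h => ⟨G.summable_vortexTerm h, _, hres, ?_⟩, ?_, ⟨?_, ?_⟩, ?_⟩
  · exact (G.summable_vortexTerm h).hasSum.mul_left _
  · rintro rfl
    exact G.onShellStab_eq_onShellProd z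
  · exact fun x N hx =>
      offShellStab_zpow_mul G.q₁_ne G.p_ne G.norm_p hz ha hK c hx N
  · exact fun ν => G.offShellStab_pole hz c ν.1
  · intro κ s hκ hk hs hinj h
    exact vertexFunction_eq_tsum G.q₂_ne ha hK hκ hk hs hinj (G.summable_vortexTerm h)
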